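/- For a continuous driver $\lambda:[0,\infty)\to\mathbb C$ and $z\in\mathbb C$ consider the Loewner equation $\partial_t g_t(z)=\frac{2}{g_t(z)-\lambda(t)}$, $g_0(z)=z$. Let $T_z\in[0,\infty]$ be its blow-up time, i.e. the time $t$ at which $\lim_{s\uparrow t}|g_s(z)-\lambda(s)|=0$ ($T_{\lambda(0)}=0$, and $T_z=\infty$ if there is no such time), and let $L_t=\{z\in\mathbb C: T_z\le t\}$ be the left hull. We say that $\lambda$ creates a two-sided curve $\gamma$ if $\gamma:\mathbb R\to\mathbb C$ is continuous, $\gamma(0)=\lambda(0)$ and $L_t=\gamma([-t,t])$ for all $t\ge 0$. For $c\in\mathbb C$ let $\lambda_c(t)=ct$. Every $\lambda_c$, $c\in\mathbb C$, creates a two-sided curve. Moreover, $\mathbb C$ is the disjoint union of the following three sets of parameters, each of which is characterized by the stated geometry of the curve; the orientation of $\gamma$ is chosen suitably. (i) Simple phase. $\lambda_c$ creates an injective two-sided curve $\gamma$ with $|\gamma(t)|\to\infty$ as $t\to+\infty$ and as $t\to-\infty$ if and only if $(\operatorname{Re}c)^2-(\operatorname{Im}c)^2>0$ or $c=0$. (ii)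 Simple phase with one spiraling end. $\lambda_c$ creates an injective two-sided curve $\gamma$ with $|\gamma(t)|\to\infty$ and $\gamma(-t)\to p$ as $t\to+\infty$, for some point $p\in\mathbb C$ that is not on $\gamma$, if and only if $(\operatorname{Re}c)^2-(\operatorname{Im}c)^2<0$. For every such $\gamma$ one has $p=2/c$. If $\operatorname{Re}c\ne0$, then the end $\gamma(-t)$ spirals into $p$: a continuous argument of $\gamma(-t)-p$, $t\ge0$, tends to $+\infty$ or to $-\infty$ as $t\to+\infty$. If $\operatorname{Re}c=0$, the spiral is degenerate: $\gamma(-t)$ lies on the segment $[0,p]$ for all $t\ge 0$. (iii) Exotic phase. One has $(\operatorname{Re}c)^2-(\operatorname{Im}c)^2=0$ and $c\neq0$ if and only if $\lambda_c$ creates a two-sided curve $\gamma$ with the following properties for some $T>0$: $\gamma$ is injective on $[0,\infty)$ with $|\gamma(t)|\to\infty$ as $t\to+\infty$; $\gamma$ restricted to $[-T,0]$ is a Jordan curve $J$ rooted at $0$ (that is, $\gamma(-T)=\gamma(0)=0$ and $\gamma$ is injective on $(-T,0]$); $\gamma(s)=0$ for all $s\le -T$; $\gamma([0,\infty))\cap\gamma((-\infty,0])=\{0\}$;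 and the interior $U$ of $J$ (the union of the bounded components of $\mathbb C\setminus J$) is open, connected, bounded and of positive area, is disjoint from $L_t$ for all $t\ge0$, and is a connected component of $\mathbb C\setminus L_t$ for all $t\ge T$. For every such $\gamma$ and $T$ one has $T=4\pi/|c|^2$. -/

import Mathlib

open Set Filter Topology MeasureTheory

noncomputable section

/-- `g` solves the Loewner equation `∂ₜ g = 2 / (g - lam)`, `g 0 = z`, on the time interval
`[0, T)`, and stays away from the singularity there. -/
structure IsLoewnerSolution (lam : ℝ → ℂ) (z : ℂ) (T : ℝ) (g : ℝ → ℂ) : Prop where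
  initial : g 0 = z
  ne_driver : ∀ t ∈ Ico 0 T, g t ≠ lam t
  hasDeriv : ∀ t ∈ Ico 0 T, HasDerivWithinAt g (2 / (g t - lam t)) (Ico 0 T) t

/-- The solution started at `z` hits the driver at time `T`. The point `z = lam 0` does so
at time `0`; any other point does so at `T > 0` if its solution lives on `[0, T)` and
`g s - lam s → 0` as `s ↑ T`. -/
def BlowsUpAt (lam : ℝ → ℂ) (z : ℂ) (T : ℝ) : Prop :=
  (T = 0 ∧ z = lam 0) ∨
    (0 < T ∧ ∃ g : ℝ → ℂ, IsLoewnerSolution lam z T g ∧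
      Tendsto (fun s => g s - lam s) (𝓝[<] T) (𝓝 0))

/-- The blow-up time `T_z`, equal to `⊤` if there is no blow-up. -/
def blowUpTime (lam : ℝ → ℂ) (z : ℂ) : EReal :=
  sInf {τ : EReal | ∃ T : ℝ, τ = (T : EReal) ∧ BlowsUpAt lam z T}

/-- The left hull `L_t = {z : T_z ≤ t}`. -/
def leftHull (lam : ℝ → ℂ) (t : ℝ) : Set ℂ :=
  {z | blowUpTime lam z ≤ (t : EReal)}

/-- The complex linear driver `t ↦ c t`. -/
def linearDriver (c : ℂ) : ℝ → ℂ := fun t => c * (t : ℂ)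

/-- `lam` creates the two-sided curve `γ : ℝ → ℂ`: the curve starts at `lam 0`, and the left
hull at time `t` is what its two ends have traced up to time `t`. -/
structure CreatesTwoSidedCurve (lam : ℝ → ℂ) (γ : ℝ → ℂ) : Prop where
  continuous : Continuous γ
  start : γ 0 = lam 0
  hull : ∀ t : ℝ, 0 ≤ t → leftHull lam t = γ '' Icc (-t) t

/-- The two-sided curve is simple, and both ends run to infinity. -/
structure IsSimpleCurve (lam : ℝ → ℂ) (γ : ℝ → ℂ) : Prop where
  creates : CreatesTwoSidedCurve lam γ
  injective : Function.Injective γ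
  tendsto_pos : Tendsto γ atTop (Bornology.cobounded ℂ)
  tendsto_neg : Tendsto (fun t => γ (-t)) atTop (Bornology.cobounded ℂ)

/-- The two-sided curve is simple, one end runs to infinity, and the other one (here the negative
one, which is a choice of orientation) converges to a point `p` off the curve. -/
structure IsSimpleCurveEndingAt (lam : ℝ → ℂ) (γ : ℝ → ℂ) (p : ℂ) : Prop where
  creates : CreatesTwoSidedCurve lam γ
  injective : Function.Injective γ
  tendsto_pos : Tendsto γ atTop (Bornology.cobounded ℂ)
  tendsto_neg : Tendsto (fun t => γ (-t)) atTop (𝓝 p)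
  notMem : p ∉ range γ

/-- `η t`, `t ≥ 0`, winds infinitely often around `p` as `t → ∞`: a continuous argument of
`η t - p` tends to `+∞` or to `-∞`. -/
def WindsInfinitely (η : ℝ → ℂ) (p : ℂ) : Prop :=
  ∃ θ : ℝ → ℝ, ContinuousOn θ (Ici 0) ∧
    (∀ t : ℝ, 0 ≤ t → η t - p = (‖η t - p‖ : ℂ) * Complex.exp ((θ t : ℂ) * Complex.I)) ∧
    (Tendsto θ atTop atTop ∨ Tendsto θ atTop atBot)

/-- The part of the complement of `J` that `J` disconnects from infinity: the union of
the bounded connected components of the complement. -/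
def interiorOf (J : Set ℂ) : Set ℂ :=
  {z | z ∉ J ∧ Bornology.IsBounded (connectedComponentIn Jᶜ z)}

/-- `γ` restricted to `[a, b]` is a Jordan curve rooted at `p`. -/
structure IsJordanCurveOn (γ : ℝ → ℂ) (a b : ℝ) (p : ℂ) : Prop where
  lt : a < b
  continuousOn : ContinuousOn γ (Icc a b)
  left : γ a = p
  right : γ b = p
  injOn : InjOn γ (Ioc a b)

/-- The exotic two-sided curve: the positive part (a choice of orientation) is simple and runs to
infinity, the negative part closes up at time `T` to a Jordan curve rooted at `0` and rests
there afterwards, the two parts meet at `0` only, and the interior of the Jordan curve is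
an open connected bounded set of positive area which is never swallowed and
is a complementary component of the left hull at all times from `T` on. -/
structure IsExoticCurve (lam : ℝ → ℂ) (γ : ℝ → ℂ) (T : ℝ) : Prop where
  creates : CreatesTwoSidedCurve lam γ
  pos_injOn : InjOn γ (Ici 0)
  tendsto_pos : Tendsto γ atTop (Bornology.cobounded ℂ)
  jordan : IsJordanCurveOn γ (-T) 0 0
  stops : ∀ s : ℝ, s ≤ -T → γ s = 0
  inter : γ '' Ici 0 ∩ γ '' Iic 0 = {0}
  interior_open : IsOpen (interiorOf (γ '' Icc (-T) 0))
  interior_connected : IsConnected (interiorOf (γ '' Icc (-T) 0))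
  interior_bounded : Bornology.IsBounded (interiorOf (γ '' Icc (-T) 0))
  interior_area : 0 < volume (interiorOf (γ '' Icc (-T) 0))
  interior_disjoint : ∀ t : ℝ, 0 ≤ t → Disjoint (interiorOf (γ '' Icc (-T) 0)) (leftHull lam t)
  interior_component : ∀ t : ℝ, T ≤ t → ∀ z ∈ interiorOf (γ '' Icc (-T) 0),
    connectedComponentIn (leftHull lam t)ᶜ z = interiorOf (γ '' Icc (-T) 0)

end

/-! Run the centred flow backwards. If `z` is swallowed at time `T`, then `y s = g (T - s) - c (T -
s)` solves the autonomous equation `y' = c - 2 / y` and starts at the singularity `0`; so the points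
swallowed at time `T > 0` are the endpoints `y T` of such trajectories. Since `(y ^ 2)' = 2 c y -
4`, a trajectory leaves `0` inside the upper or the lower half of the cone `|Re| < |Im|`. Two
trajectories in the same half satisfy `Re (y₁ y₂) < 0`, which keeps their distance from growing, so
they coincide. Hence at most two points are swallowed at a time (`eqOn_or_eqOn_or_eqOn`), and
autonomy makes the swallowing time of a point unique (`endpoint_ne_of_lt`). The two trajectories are
the two halves of the curve.

For `c ≠ 0` the equation integrates: with `ζ = log (1 - c y / 2)` and `potential ζ = 1 + ζ - exp ζ`
it becomes `potential (ζ s) = (c ^ 2 / 2) s`. The trajectories are thus the two lifts of a ray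
through a map whose critical points `2 π i n` are also its critical values. The sign of `Re (c ^ 2)`
decides their fate. If it is positive, the lifts stay in the strips `0 < |Im ζ| < 2 π` and both ends
escape. If it is negative, one lift stays in a right half-strip and escapes; on the other `Re ζ →
-∞`, so `y → 2 / c`, while `Im ζ` follows `Im (c ^ 2 / 2) s` up to a bounded error and produces the
spiral. If it is zero, the ray runs along the imaginary axis and meets the critical value `± 2 π i`
at time `4 π / |c| ^ 2`. There the left lift has `exp ζ = 1`, so `y` is back at `0` and has traced,
in the coordinate `q = 1 - c z / 2`, the loop `|q| = exp (Re q - 1)`, `|q| ≤ 1`.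

For the converses, an injective curve must consist of the two trajectories, whose limits are known,
and the number of points swallowed at a time singles out the exotic case (`IsBranchPair`,
`IsLoopPair`). -/

/-! ### The reversed equation and its trajectories out of the singularity. -/

/-- `y` solves the time-reversed, centred Loewner equation `y' = c - 2 / y` for the driver
`t ↦ c t` on `(0, T]`, and emanates from the singularity `0`. -/
structure IsReverseTrajectory (c : ℂ) (T : ℝ) (y : ℝ → ℂ) : Prop where
  start : y 0 = 0
  continuousOn : ContinuousOn y (Icc 0 T)
  ne_zero : ∀ s ∈ Ioc 0 T, y s ≠ 0
  hasDeriv : ∀ s ∈ Ioc 0 T, HasDerivWithinAt y (c - 2 / y s) (Ioc 0 T) s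

namespace IsReverseTrajectory

variable {c : ℂ} {T : ℝ} {y y₁ y₂ y₃ : ℝ → ℂ}

theorem mono (h : IsReverseTrajectory c T y) {S : ℝ} (hS : S ≤ T) :
    IsReverseTrajectory c S y where
  start := h.start
  continuousOn := h.continuousOn.mono (Icc_subset_Icc_right hS)
  ne_zero s hs := h.ne_zero s ⟨hs.1, hs.2.trans hS⟩
  hasDeriv s hs := (h.hasDeriv s ⟨hs.1, hs.2.trans hS⟩).mono (Ioc_subset_Ioc_right hS)

theorem hasDerivAt (h : IsReverseTrajectory c T y) {s : ℝ} (hs : s ∈ Ioo 0 T) :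
    HasDerivAt y (c - 2 / y s) s :=
  (h.hasDeriv s ⟨hs.1, hs.2.le⟩).hasDerivAt (Ioc_mem_nhds hs.1 hs.2)

end IsReverseTrajectory

theorem lipschitzOnWith_reverse_field (c : ℂ) {δ : ℝ} (hδ : 0 < δ) :
    LipschitzOnWith (Real.toNNReal (2 / δ ^ 2)) (fun w : ℂ => c - 2 / w) {w | δ ≤ ‖w‖} := by
  rw [lipschitzOnWith_iff_norm_sub_le]
  intro x hx y hy
  have hx' : δ ≤ ‖x‖ := hx
  have hy' : δ ≤ ‖y‖ := hy
  have hx0 : x ≠ 0 := norm_pos_iff.1 (hδ.trans_le hx')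
  have hy0 : y ≠ 0 := norm_pos_iff.1 (hδ.trans_le hy')
  have : c - 2 / x - (c - 2 / y) = 2 / (x * y) * (x - y) := by field_simp; ring
  rw [this, norm_mul, Real.coe_toNNReal _ (by positivity), norm_div, norm_mul]
  have h2 : ‖(2 : ℂ)‖ = 2 := by simp
  rw [h2]
  gcongr
  rw [sq]
  gcongr

/-- Uniqueness for the reversed Loewner equation: two solutions which agree at one time agree. -/
theorem reverse_solution_unique {c : ℂ} {T : ℝ} {y₁ y₂ : ℝ → ℂ}
    (h₁ : ∀ s ∈ Ioc 0 T, y₁ s ≠ 0) (h₂ : ∀ s ∈ Ioc 0 T, y₂ s ≠ 0)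
    (d₁ : ∀ s ∈ Ioc 0 T, HasDerivWithinAt y₁ (c - 2 / y₁ s) (Ioc 0 T) s)
    (d₂ : ∀ s ∈ Ioc 0 T, HasDerivWithinAt y₂ (c - 2 / y₂ s) (Ioc 0 T) s)
    {s₀ : ℝ} (hs₀ : s₀ ∈ Ioc 0 T) (heq : y₁ s₀ = y₂ s₀) : EqOn y₁ y₂ (Ioc 0 T) := by
  -- The field is Lipschitz only away from `0`. Compactness of `[a, T]` supplies the lower bound on
  -- the norm, and uniqueness is then run from `s₀` in both directions.
  have lower : ∀ y : ℝ → ℂ, (∀ s ∈ Ioc 0 T, y s ≠ 0) →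
      (∀ s ∈ Ioc 0 T, HasDerivWithinAt y (c - 2 / y s) (Ioc 0 T) s) →
      ∀ a, 0 < a → a ≤ T → ∃ δ > 0, ∀ s ∈ Icc a T, δ ≤ ‖y s‖ := by
    intro y hy dy a ha haT
    have hc : ContinuousOn (fun s => ‖y s‖) (Icc a T) := fun s hs =>
      ((dy s ⟨ha.trans_le hs.1, hs.2⟩).continuousWithinAt.mono
        (fun t ht => ⟨ha.trans_le ht.1, ht.2⟩)).norm
    obtain ⟨m, hm, hmin⟩ := isCompact_Icc.exists_isMinOn ⟨a, left_mem_Icc.2 haT⟩ hc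
    exact ⟨‖y m‖, norm_pos_iff.2 (hy m ⟨ha.trans_le hm.1, hm.2⟩), fun s hs => hmin hs⟩
  have cont : ∀ y : ℝ → ℂ,
      (∀ s ∈ Ioc 0 T, HasDerivWithinAt y (c - 2 / y s) (Ioc 0 T) s) →
      ContinuousOn y (Ioc 0 T) := fun y dy s hs => (dy s hs).continuousWithinAt
  intro s hs
  rcases le_total s₀ s with hle | hle
  · obtain ⟨δ₁, hδ₁, hl₁⟩ := lower y₁ h₁ d₁ s₀ hs₀.1 hs₀.2
    obtain ⟨δ₂, hδ₂, hl₂⟩ := lower y₂ h₂ d₂ s₀ hs₀.1 hs₀.2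
    have sub : Icc s₀ T ⊆ Ioc 0 T := fun t ht => ⟨hs₀.1.trans_le ht.1, ht.2⟩
    have right : ∀ y : ℝ → ℂ,
        (∀ s ∈ Ioc 0 T, HasDerivWithinAt y (c - 2 / y s) (Ioc 0 T) s) →
        ∀ t ∈ Ico s₀ T, HasDerivWithinAt y (c - 2 / y t) (Ici t) t := fun y dy t ht =>
      ((dy t (sub ⟨ht.1, ht.2.le⟩)).hasDerivAt
        (Ioc_mem_nhds (hs₀.1.trans_le ht.1) ht.2)).hasDerivWithinAt
    exact ODE_solution_unique_of_mem_Icc_right (v := fun _ w => c - 2 / w)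
      (s := fun _ => {w | min δ₁ δ₂ ≤ ‖w‖})
      (fun t _ => lipschitzOnWith_reverse_field c (lt_min hδ₁ hδ₂))
      ((cont y₁ d₁).mono sub) (right y₁ d₁)
      (fun t ht => (min_le_left _ _).trans (hl₁ t ⟨ht.1, ht.2.le⟩))
      ((cont y₂ d₂).mono sub) (right y₂ d₂)
      (fun t ht => (min_le_right _ _).trans (hl₂ t ⟨ht.1, ht.2.le⟩)) heq ⟨hle, hs.2⟩
  · obtain ⟨δ₁, hδ₁, hl₁⟩ := lower y₁ h₁ d₁ s hs.1 hs.2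
    obtain ⟨δ₂, hδ₂, hl₂⟩ := lower y₂ h₂ d₂ s hs.1 hs.2
    have sub : Icc s s₀ ⊆ Ioc 0 T := fun t ht => ⟨hs.1.trans_le ht.1, ht.2.trans hs₀.2⟩
    have left : ∀ y : ℝ → ℂ,
        (∀ s ∈ Ioc 0 T, HasDerivWithinAt y (c - 2 / y s) (Ioc 0 T) s) →
        ∀ t ∈ Ioc s s₀, HasDerivWithinAt y (c - 2 / y t) (Iic t) t := fun y dy t ht =>
      (dy t (sub ⟨ht.1.le, ht.2⟩)).mono_of_mem_nhdsWithin
        (mem_of_superset (Ioc_mem_nhdsLE (hs.1.trans ht.1))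
          (Ioc_subset_Ioc_right (ht.2.trans hs₀.2)))
    exact ODE_solution_unique_of_mem_Icc_left (v := fun _ w => c - 2 / w)
      (s := fun _ => {w | min δ₁ δ₂ ≤ ‖w‖})
      (fun t _ => lipschitzOnWith_reverse_field c (lt_min hδ₁ hδ₂))
      ((cont y₁ d₁).mono sub) (left y₁ d₁)
      (fun t ht => (min_le_left _ _).trans (hl₁ t ⟨ht.1.le, ht.2.trans hs₀.2⟩))
      ((cont y₂ d₂).mono sub) (left y₂ d₂)
      (fun t ht => (min_le_right _ _).trans (hl₂ t ⟨ht.1.le, ht.2.trans hs₀.2⟩)) heq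
      ⟨le_rfl, hle⟩

namespace IsReverseTrajectory

variable {c : ℂ} {T : ℝ} {y y₁ y₂ y₃ : ℝ → ℂ}

theorem eqOn_of_eq (h₁ : IsReverseTrajectory c T y₁) (h₂ : IsReverseTrajectory c T y₂)
    {s : ℝ} (hs : s ∈ Ioc 0 T) (h : y₁ s = y₂ s) : EqOn y₁ y₂ (Ioc 0 T) :=
  reverse_solution_unique h₁.ne_zero h₂.ne_zero h₁.hasDeriv h₂.hasDeriv hs h

/-- Two reverse trajectories of different lengths end at different points. -/
theorem endpoint_ne_of_lt {S : ℝ} (h₁ : IsReverseTrajectory c S y₁)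
    (h₂ : IsReverseTrajectory c T y₂) (hS : 0 < S) (hST : S < T) : y₁ S ≠ y₂ T := by
  intro heq
  set d := T - S with hd
  have hdpos : 0 < d := sub_pos.2 hST
  have maps : MapsTo (fun s => s + d) (Ioc 0 S) (Ioc 0 T) := fun s hs =>
    ⟨by dsimp only; linarith [hs.1], by dsimp only; linarith [hs.2]⟩
  -- The equation is autonomous, so the shift of `y₂` by `d` solves it too and agrees with `y₁` at
  -- `S`. Letting `s → 0` would then give `y₂ d = 0`.
  have key : EqOn y₁ (fun s => y₂ (s + d)) (Ioc 0 S) := by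
    refine reverse_solution_unique (c := c) h₁.ne_zero (fun s hs => h₂.ne_zero _ (maps hs))
      h₁.hasDeriv (fun s hs => ?_) (right_mem_Ioc.2 hS) (by simp [hd, heq])
    have := (h₂.hasDeriv (s + d) (maps hs)).scomp s
      ((hasDerivWithinAt_id s (Ioc 0 S)).add_const d) maps
    exact this.congr_deriv (one_smul ℝ _)
  have t₁ : Tendsto y₁ (𝓝[>] 0) (𝓝 0) := by
    have := (h₁.continuousOn 0 (left_mem_Icc.2 hS.le)).tendsto
    rw [h₁.start] at this
    refine this.mono_left ?_
    rw [← nhdsWithin_Ioc_eq_nhdsGT hS]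
    exact nhdsWithin_mono _ Ioc_subset_Icc_self
  have t₂ : Tendsto (fun s => y₂ (s + d)) (𝓝[>] 0) (𝓝 (y₂ d)) := by
    have hc : ContinuousAt y₂ (0 + d) := by
      rw [zero_add]; exact (h₂.hasDerivAt ⟨hdpos, by linarith⟩).continuousAt
    have hs : ContinuousAt (fun s : ℝ => s + d) 0 := by fun_prop
    have := (ContinuousAt.comp (f := fun s : ℝ => s + d) hc hs).tendsto
    simp only [Function.comp_def, zero_add] at this
    exact this.mono_left nhdsWithin_le_nhds
  have ev : y₁ =ᶠ[𝓝[>] 0] fun s => y₂ (s + d) :=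
    eventually_of_mem (Ioc_mem_nhdsGT hS) key
  exact h₂.ne_zero d ⟨hdpos, by linarith⟩ (tendsto_nhds_unique t₂ (t₁.congr' ev))

/-- A reverse trajectory leaves the singularity inside the double cone `|Re| < |Im|`, and stays
in one half of that cone for a while. -/
theorem exists_im_sign (h : IsReverseTrajectory c T y) (hT : 0 < T) :
    ∃ ε ∈ Ioc 0 T, (∀ s ∈ Ioc 0 ε, |(y s).re| < (y s).im) ∨
      (∀ s ∈ Ioc 0 ε, |(y s).re| < -(y s).im) := by
  have hcont := h.continuousOn 0 (left_mem_Icc.2 hT.le)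
  have hre : ContinuousWithinAt (fun s => (2 * c * y s - 4).re) (Icc 0 T) 0 := by
    exact Complex.continuous_re.continuousAt.comp_continuousWithinAt
      ((hcont.const_mul (2 * c)).sub continuousWithinAt_const)
  have hneg : ∀ᶠ s in 𝓝[Icc 0 T] 0, (2 * c * y s - 4).re < 0 := by
    refine hre.eventually_lt continuousWithinAt_const ?_
    simp [h.start]
  obtain ⟨ε, hε, hεT⟩ : ∃ ε ∈ Ioc 0 T, ∀ s ∈ Icc 0 ε, (2 * c * y s - 4).re < 0 := by
    rw [nhdsWithin_Icc_eq_nhdsGE hT] at hneg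
    obtain ⟨u, hu, hsub⟩ := mem_nhdsGE_iff_exists_Icc_subset.1 hneg
    exact ⟨min u T, ⟨lt_min hu hT, min_le_right _ _⟩, fun s hs =>
      hsub ⟨hs.1, hs.2.trans (min_le_left _ _)⟩⟩
  have hcε : ContinuousOn y (Icc 0 ε) := h.continuousOn.mono (Icc_subset_Icc_right hε.2)
  -- From `(y ^ 2)' = 2 c y - 4`; negativity of `Re (y ^ 2)` is membership in the double cone.
  have anti : StrictAntiOn (fun s => (y s ^ 2).re) (Icc 0 ε) := by
    refine strictAntiOn_of_hasDerivWithinAt_neg (convex_Icc 0 ε)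
      (f' := fun s => (2 * c * y s - 4).re)
      (Complex.continuous_re.comp_continuousOn (hcε.pow 2)) (fun s hs => ?_) (fun s hs => ?_)
    · rw [interior_Icc] at hs ⊢
      have hs' : s ∈ Ioo 0 T := ⟨hs.1, hs.2.trans_le hε.2⟩
      have hne := h.ne_zero s ⟨hs'.1, hs'.2.le⟩
      have h1 := (h.hasDerivAt hs').pow 2
      have h2 := (Complex.reCLM.hasFDerivAt.comp_hasDerivAt s h1)
      refine (h2.congr_deriv ?_).hasDerivWithinAt
      simp only [Complex.reCLM_apply]
      congr 1
      field_simp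
      push_cast
      ring
    · rw [interior_Icc] at hs
      exact hεT s ⟨hs.1.le, hs.2.le⟩
  have hsq : ∀ s ∈ Ioc 0 ε, |(y s).re| < |(y s).im| := by
    intro s hs
    have := anti (left_mem_Icc.2 hε.1.le) ⟨hs.1.le, hs.2⟩ hs.1
    simp only [h.start, sq, Complex.mul_re, mul_zero, Complex.zero_re] at this
    rw [← sq_lt_sq]
    nlinarith
  refine ⟨ε, hε, ?_⟩
  have hcim : ContinuousOn (fun s => (y s).im) (Ioc 0 ε) :=
    Complex.continuous_im.comp_continuousOn (hcε.mono Ioc_subset_Icc_self)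
  have him : ∀ s ∈ Ioc 0 ε, (y s).im ≠ 0 := fun s hs h0 => by
    have := hsq s hs
    rw [h0, abs_zero] at this
    exact absurd this (not_lt.2 (abs_nonneg _))
  have hεm : ε ∈ Ioc 0 ε := right_mem_Ioc.2 hε.1
  rcases lt_or_gt_of_ne (him ε hεm) with hlt | hgt
  · right
    intro s hs
    have : (y s).im < 0 := by
      by_contra hcon
      obtain ⟨r, hr, hr0⟩ := isPreconnected_Ioc.intermediate_value hεm hs hcim
        ⟨hlt.le, not_lt.1 hcon⟩
      exact him r hr hr0
    rw [← abs_of_neg this]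
    exact hsq s hs
  · left
    intro s hs
    have : 0 < (y s).im := by
      by_contra hcon
      obtain ⟨r, hr, hr0⟩ := isPreconnected_Ioc.intermediate_value hs hεm hcim
        ⟨not_lt.1 hcon, hgt.le⟩
      exact him r hr hr0
    rw [← abs_of_pos this]
    exact hsq s hs

/-- The difference `P` satisfies `P' = 2 P / (y₁ y₂)`, so the sign condition makes `‖P‖ ^ 2`
nonincreasing, and it starts at `0`. -/
theorem eq_of_re_mul_neg (h₁ : IsReverseTrajectory c T y₁) (h₂ : IsReverseTrajectory c T y₂)
    (hT : 0 < T) (hneg : ∀ s ∈ Ioc 0 T, (y₁ s * y₂ s).re < 0) : y₁ T = y₂ T := by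
  have anti : AntitoneOn (fun s => ‖y₁ s - y₂ s‖ ^ 2) (Icc 0 T) := by
    refine antitoneOn_of_hasDerivWithinAt_nonpos (convex_Icc 0 T)
      (f' := fun s => 2 * inner ℝ (y₁ s - y₂ s) (2 / (y₁ s * y₂ s) * (y₁ s - y₂ s)))
      ((h₁.continuousOn.sub h₂.continuousOn).norm.pow 2) (fun s hs => ?_) (fun s hs => ?_)
    · rw [interior_Icc] at hs ⊢
      have n₁ := h₁.ne_zero s ⟨hs.1, hs.2.le⟩
      have n₂ := h₂.ne_zero s ⟨hs.1, hs.2.le⟩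
      have hd := ((h₁.hasDerivAt hs).sub (h₂.hasDerivAt hs)).hasDerivWithinAt (s := Ioo 0 T)
      refine (hd.congr_deriv ?_).norm_sq
      field_simp
      ring
    · rw [interior_Icc] at hs
      have hn := hneg s ⟨hs.1, hs.2.le⟩
      set P := y₁ s - y₂ s
      set Q := y₁ s * y₂ s
      have : (inner ℝ P (2 / Q * P) : ℝ) = 2 * Q.re / Complex.normSq Q * Complex.normSq P := by
        rw [Complex.inner, div_eq_mul_inv, Complex.inv_def]
        simp [Complex.normSq_apply]
        ring
      rw [this]
      have h1 : 2 * Q.re / Complex.normSq Q ≤ 0 :=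
        div_nonpos_of_nonpos_of_nonneg (by linarith) (Complex.normSq_nonneg _)
      have h2 := mul_nonpos_of_nonpos_of_nonneg h1 (Complex.normSq_nonneg P)
      linarith
  have h := anti (left_mem_Icc.2 hT.le) (right_mem_Icc.2 hT.le) hT.le
  simp only [h₁.start, h₂.start, sub_zero, norm_zero] at h
  have h0 : ‖y₁ T - y₂ T‖ = 0 := by
    have := norm_nonneg (y₁ T - y₂ T)
    nlinarith
  exact sub_eq_zero.1 (norm_eq_zero.1 h0)

/-- In a common half-cone the product of the imaginary parts exceeds that of the real parts, so `Re
(y₁ y₂) < 0` near time `0`. The sign `σ` treats both halves at once. -/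
theorem eqOn_of_im_sign (h₁ : IsReverseTrajectory c T y₁) (h₂ : IsReverseTrajectory c T y₂)
    {ε₁ ε₂ : ℝ} (hε₁ : ε₁ ∈ Ioc 0 T) (hε₂ : ε₂ ∈ Ioc 0 T) {σ : ℝ} (hσ : σ ^ 2 = 1)
    (s₁ : ∀ s ∈ Ioc 0 ε₁, |(y₁ s).re| < σ * (y₁ s).im)
    (s₂ : ∀ s ∈ Ioc 0 ε₂, |(y₂ s).re| < σ * (y₂ s).im) : EqOn y₁ y₂ (Ioc 0 T) := by
  have hpos : 0 < min ε₁ ε₂ := lt_min hε₁.1 hε₂.1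
  have hle : min ε₁ ε₂ ≤ T := (min_le_left _ _).trans hε₁.2
  refine h₁.eqOn_of_eq h₂ ⟨hpos, hle⟩ (eq_of_re_mul_neg (h₁.mono hle) (h₂.mono hle) hpos ?_)
  intro s hs
  have a := s₁ s ⟨hs.1, hs.2.trans (min_le_left _ _)⟩
  have b := s₂ s ⟨hs.1, hs.2.trans (min_le_right _ _)⟩
  have hmul := mul_lt_mul'' a b (abs_nonneg _) (abs_nonneg _)
  rw [← abs_mul] at hmul
  have := le_abs_self ((y₁ s).re * (y₂ s).re)
  have e : σ * (y₁ s).im * (σ * (y₂ s).im) = (y₁ s).im * (y₂ s).im := by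
    linear_combination (y₁ s).im * (y₂ s).im * hσ
  rw [Complex.mul_re]
  linarith

/-- Only two different trajectories emanate from the singularity. -/
theorem eqOn_or_eqOn_or_eqOn (h₁ : IsReverseTrajectory c T y₁) (h₂ : IsReverseTrajectory c T y₂)
    (h₃ : IsReverseTrajectory c T y₃) (hT : 0 < T) :
    EqOn y₁ y₂ (Ioc 0 T) ∨ EqOn y₁ y₃ (Ioc 0 T) ∨ EqOn y₂ y₃ (Ioc 0 T) := by
  have sgn : ∀ y, IsReverseTrajectory c T y → ∃ ε ∈ Ioc 0 T, ∃ σ : ℝ, (σ = 1 ∨ σ = -1) ∧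
      ∀ s ∈ Ioc 0 ε, |(y s).re| < σ * (y s).im := by
    intro y hy
    obtain ⟨ε, hε, h | h⟩ := hy.exists_im_sign hT
    · exact ⟨ε, hε, 1, Or.inl rfl, by simpa using h⟩
    · exact ⟨ε, hε, -1, Or.inr rfl, by simpa using h⟩
  obtain ⟨ε₁, e₁, σ₁, hσ₁, s₁⟩ := sgn y₁ h₁
  obtain ⟨ε₂, e₂, σ₂, hσ₂, s₂⟩ := sgn y₂ h₂
  obtain ⟨ε₃, e₃, σ₃, hσ₃, s₃⟩ := sgn y₃ h₃
  have hsq : σ₁ ^ 2 = 1 ∧ σ₂ ^ 2 = 1 := by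
    constructor
    · rcases hσ₁ with h | h <;> simp [h]
    · rcases hσ₂ with h | h <;> simp [h]
  have : σ₁ = σ₂ ∨ σ₁ = σ₃ ∨ σ₂ = σ₃ := by
    rcases hσ₁ with h | h <;> rcases hσ₂ with h' | h' <;> rcases hσ₃ with h'' | h'' <;>
      simp [h, h', h'']
  rcases this with h | h | h
  · exact Or.inl (h₁.eqOn_of_im_sign h₂ e₁ e₂ hsq.1 s₁ (h ▸ s₂))
  · exact Or.inr (Or.inl (h₁.eqOn_of_im_sign h₃ e₁ e₃ hsq.1 s₁ (h ▸ s₃)))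
  · exact Or.inr (Or.inr (h₂.eqOn_of_im_sign h₃ e₂ e₃ hsq.2 s₂ (h ▸ s₃)))

end IsReverseTrajectory

/-! ### Blow-up times and hulls in terms of reverse trajectories. -/

theorem IsLoewnerSolution.exists_reverse {c z : ℂ} {T : ℝ} {g : ℝ → ℂ} (hT : 0 < T)
    (h : IsLoewnerSolution (linearDriver c) z T g)
    (hlim : Tendsto (fun s => g s - linearDriver c s) (𝓝[<] T) (𝓝 0)) :
    ∃ y, IsReverseTrajectory c T y ∧ y T = z := by
  -- The value at `0` is prescribed because `g T` is arbitrary.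
  set y : ℝ → ℂ := fun s => if s = 0 then 0 else g (T - s) - c * ((T - s : ℝ) : ℂ) with hy
  have hy' : EqOn y (fun s => g (T - s) - c * ((T - s : ℝ) : ℂ)) (Ioc 0 T) := fun s hs => by
    simp [hy, hs.1.ne']
  have maps : MapsTo (fun s => T - s) (Ioc 0 T) (Ico 0 T) := fun s hs =>
    ⟨by dsimp only; linarith [hs.2], by dsimp only; linarith [hs.1]⟩
  have hne : ∀ s ∈ Ioc 0 T, y s ≠ 0 := fun s hs => by
    rw [hy' hs]
    exact sub_ne_zero.2 (h.ne_driver _ (maps hs))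
  have hder : ∀ s ∈ Ioc 0 T, HasDerivWithinAt y (c - 2 / y s) (Ioc 0 T) s := fun s hs => by
    have hid : HasDerivWithinAt (fun s : ℝ => T - s) (-1) (Ioc 0 T) s :=
      (hasDerivWithinAt_id s _).const_sub T
    have h1 := (h.hasDeriv _ (maps hs)).scomp s hid maps
    have h2 : HasDerivWithinAt (fun s : ℝ => c * ((T - s : ℝ) : ℂ)) (c * ((-1 : ℝ) : ℂ))
        (Ioc 0 T) s := hid.ofReal_comp.const_mul c
    refine ((h1.sub h2).congr_deriv ?_).congr hy' (hy' hs)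
    rw [hy' hs]
    simp [linearDriver]
    ring
  refine ⟨y, ⟨by simp [hy], fun s hs => ?_, hne, hder⟩, ?_⟩
  · rcases hs.1.eq_or_lt with rfl | hpos
    · rw [← Ioc_insert_left hs.2, continuousWithinAt_insert_self]
      have hsub : Tendsto (fun s : ℝ => T - s) (𝓝[Ioc 0 T] 0) (𝓝[<] T) := by
        refine tendsto_nhdsWithin_iff.2 ⟨?_, eventually_of_mem self_mem_nhdsWithin
          fun s hs => (maps hs).2⟩
        have : Tendsto (fun s : ℝ => T - s) (𝓝 0) (𝓝 (T - 0)) := by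
          apply Continuous.tendsto; fun_prop
        rw [sub_zero] at this
        exact this.mono_left nhdsWithin_le_nhds
      have := hlim.comp hsub
      have h0 : y 0 = 0 := by simp [hy]
      rw [ContinuousWithinAt, h0]
      refine this.congr' (eventually_of_mem self_mem_nhdsWithin fun s hs => ?_)
      simp [hy' hs, linearDriver]
    · exact (hder s ⟨hpos, hs.2⟩).continuousWithinAt.mono_of_mem_nhdsWithin
        (mem_nhdsWithin.2 ⟨Ioi 0, isOpen_Ioi, hpos, fun t ht => ⟨ht.1, ht.2.2⟩⟩)
  · rw [hy' (right_mem_Ioc.2 hT)]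
    simp [h.initial]

theorem IsReverseTrajectory.blowsUpAt {c : ℂ} {T : ℝ} {y : ℝ → ℂ} (hT : 0 < T)
    (h : IsReverseTrajectory c T y) : BlowsUpAt (linearDriver c) (y T) T := by
  have maps : MapsTo (fun s => T - s) (Ico 0 T) (Ioc 0 T) := fun s hs =>
    ⟨by dsimp only; linarith [hs.2], by dsimp only; linarith [hs.1]⟩
  refine Or.inr ⟨hT, fun t => y (T - t) + c * (t : ℂ), ⟨by simp, fun t ht => ?_,
    fun t ht => ?_⟩, ?_⟩
  · have := h.ne_zero _ (maps ht)
    simpa [linearDriver] using this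
  · have hid : HasDerivWithinAt (fun s : ℝ => T - s) (-1) (Ico 0 T) t :=
      (hasDerivWithinAt_id t _).const_sub T
    have h1 := (h.hasDeriv _ (maps ht)).scomp t hid maps
    have h2 : HasDerivWithinAt (fun s : ℝ => c * (s : ℂ)) (c * ((1 : ℝ) : ℂ)) (Ico 0 T) t :=
      ((hasDerivWithinAt_id t _).ofReal_comp).const_mul c
    refine (h1.add h2).congr_deriv ?_
    simp [linearDriver]
  · have h0 := (h.continuousOn 0 (left_mem_Icc.2 hT.le)).tendsto
    rw [h.start] at h0
    have hsub : Tendsto (fun s : ℝ => T - s) (𝓝[<] T) (𝓝[Icc 0 T] 0) := by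
      refine tendsto_nhdsWithin_iff.2 ⟨?_, eventually_of_mem (Ico_mem_nhdsLT hT)
        fun s hs => Ioc_subset_Icc_self (maps hs)⟩
      have : Tendsto (fun s : ℝ => T - s) (𝓝 T) (𝓝 (T - T)) := by
        apply Continuous.tendsto; fun_prop
      rw [sub_self] at this
      exact this.mono_left nhdsWithin_le_nhds
    refine (h0.comp hsub).congr fun s => ?_
    simp [linearDriver]

theorem blowsUpAt_linearDriver_iff {c z : ℂ} {T : ℝ} : BlowsUpAt (linearDriver c) z T ↔
    (T = 0 ∧ z = 0) ∨ (0 < T ∧ ∃ y, IsReverseTrajectory c T y ∧ y T = z) := by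
  constructor
  · rintro (⟨h, h'⟩ | ⟨hT, g, hg, hlim⟩)
    · exact Or.inl ⟨h, by simpa [linearDriver] using h'⟩
    · exact Or.inr ⟨hT, hg.exists_reverse hT hlim⟩
  · rintro (⟨h, h'⟩ | ⟨hT, y, hy, rfl⟩)
    · exact Or.inl ⟨h, by simpa [linearDriver] using h'⟩
    · exact hy.blowsUpAt hT

theorem blowsUpAt_zero_iff {c z : ℂ} : BlowsUpAt (linearDriver c) z 0 ↔ z = 0 := by
  simp [blowsUpAt_linearDriver_iff]

theorem BlowsUpAt.nonneg {c z : ℂ} {T : ℝ} (h : BlowsUpAt (linearDriver c) z T) : 0 ≤ T := by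
  rcases h with h | h
  · exact h.1.ge
  · exact h.1.le

theorem BlowsUpAt.time_not_lt {c z : ℂ} {S T : ℝ} (hS : BlowsUpAt (linearDriver c) z S)
    (hT : BlowsUpAt (linearDriver c) z T) : ¬ S < T := by
  intro hlt
  rcases blowsUpAt_linearDriver_iff.1 hT with ⟨h, -⟩ | ⟨hT0, y₂, hy₂, e₂⟩
  · exact absurd hS.nonneg (not_le.2 (h ▸ hlt))
  rcases blowsUpAt_linearDriver_iff.1 hS with ⟨-, hz⟩ | ⟨hS0, y₁, hy₁, e₁⟩
  · exact hy₂.ne_zero T (right_mem_Ioc.2 hT0) (e₂.trans hz)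
  · exact hy₁.endpoint_ne_of_lt hy₂ hS0 hlt (e₁.trans e₂.symm)

theorem BlowsUpAt.unique {c z : ℂ} {S T : ℝ} (hS : BlowsUpAt (linearDriver c) z S)
    (hT : BlowsUpAt (linearDriver c) z T) : S = T :=
  le_antisymm (not_lt.1 (hT.time_not_lt hS)) (not_lt.1 (hS.time_not_lt hT))

/-- A point has at most one blow-up time, so the infimum is attained unless the set is empty, in
which case it is `⊤`. -/
theorem mem_leftHull_iff {c z : ℂ} {t : ℝ} : z ∈ leftHull (linearDriver c) t ↔
    ∃ T ≤ t, BlowsUpAt (linearDriver c) z T := by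
  constructor
  · intro h
    by_cases hex : ∃ T, BlowsUpAt (linearDriver c) z T
    · obtain ⟨T, hT⟩ := hex
      refine ⟨T, ?_, hT⟩
      have : blowUpTime (linearDriver c) z = (T : EReal) := by
        have hset : {τ : EReal | ∃ T : ℝ, τ = (T : EReal) ∧ BlowsUpAt (linearDriver c) z T}
            = {(T : EReal)} := by
          ext τ
          constructor
          · rintro ⟨S, rfl, hS⟩
            rw [hS.unique hT]
            rfl
          · rintro rfl
            exact ⟨T, rfl, hT⟩
        rw [blowUpTime, hset, sInf_singleton]
      rw [leftHull, mem_ofPred_eq, this] at h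
      exact_mod_cast h
    · exfalso
      have hset : {τ : EReal | ∃ T : ℝ, τ = (T : EReal) ∧ BlowsUpAt (linearDriver c) z T} = ∅ :=
        eq_empty_of_forall_notMem fun τ ⟨T, _, hT⟩ => hex ⟨T, hT⟩
      rw [leftHull, mem_ofPred_eq, blowUpTime, hset, sInf_empty] at h
      exact absurd h (not_le.2 (EReal.coe_lt_top t))
  · rintro ⟨T, hT, hb⟩
    exact (sInf_le ⟨T, rfl, hb⟩ : blowUpTime (linearDriver c) z ≤ T).trans (by exact_mod_cast hT)

/-! ### Two-sided curves and the times at which their points are swallowed. -/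

/-- The two-sided curve with given positive and negative halves. -/
noncomputable def twoSided (γp γm : ℝ → ℂ) (t : ℝ) : ℂ := if 0 ≤ t then γp t else γm (-t)

section twoSided

variable {γp γm : ℝ → ℂ}

theorem twoSided_of_nonneg {t : ℝ} (ht : 0 ≤ t) : twoSided γp γm t = γp t := if_pos ht

theorem twoSided_neg (h0 : γp 0 = γm 0) {t : ℝ} (ht : 0 ≤ t) :
    twoSided γp γm (-t) = γm t := by
  rcases ht.eq_or_lt with rfl | h
  · simp [twoSided, h0]
  · simp [twoSided, h]

theorem continuous_twoSided (h0 : γp 0 = γm 0) (hp : ContinuousOn γp (Ici 0))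
    (hm : ContinuousOn γm (Ici 0)) : Continuous (twoSided γp γm) := by
  have h1 : ContinuousOn (twoSided γp γm) (Ici 0) := hp.congr fun t ht => twoSided_of_nonneg ht
  have h2 : ContinuousOn (twoSided γp γm) (Iic 0) := by
    have : ContinuousOn (fun t => γm (-t)) (Iic 0) :=
      hm.comp continuousOn_neg fun t ht => by simpa using ht
    refine this.congr fun t ht => ?_
    simpa using twoSided_neg (γp := γp) h0 (neg_nonneg.2 ht)
  rw [← continuousOn_univ, ← Iic_union_Ici (a := (0 : ℝ))]
  exact h2.union_of_isClosed h1 isClosed_Iic isClosed_Ici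

/-- The clause `z ≠ 0` allows `γm` to rest at `0` after closing a loop: `0` is swallowed at time `0`
and never again. -/
theorem createsTwoSidedCurve_twoSided {c : ℂ} (hp0 : γp 0 = 0) (hm0 : γm 0 = 0)
    (hp : ContinuousOn γp (Ici 0)) (hm : ContinuousOn γm (Ici 0))
    (hlev : ∀ T > 0, ∀ z, BlowsUpAt (linearDriver c) z T ↔ z = γp T ∨ (z = γm T ∧ z ≠ 0)) :
    CreatesTwoSidedCurve (linearDriver c) (twoSided γp γm) := by
  have h0 : γp 0 = γm 0 := hp0.trans hm0.symm
  refine ⟨continuous_twoSided h0 hp hm, ?_, fun t ht => ?_⟩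
  · simp [twoSided, linearDriver, hp0]
  ext z
  rw [mem_leftHull_iff]
  constructor
  · rintro ⟨T, hT, hb⟩
    rcases hb.nonneg.eq_or_lt with rfl | hpos
    · refine ⟨0, ⟨by linarith, hT⟩, ?_⟩
      rw [blowsUpAt_zero_iff.1 hb, twoSided_of_nonneg le_rfl, hp0]
    rcases (hlev T hpos z).1 hb with rfl | ⟨rfl, -⟩
    · exact ⟨T, ⟨by linarith, hT⟩, twoSided_of_nonneg hpos.le⟩
    · exact ⟨-T, ⟨by linarith, by linarith⟩, twoSided_neg h0 hpos.le⟩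
  · rintro ⟨s, hs, rfl⟩
    by_cases hz : twoSided γp γm s = 0
    · exact ⟨0, ht, blowsUpAt_zero_iff.2 hz⟩
    rcases lt_trichotomy s 0 with hneg | rfl | hpos
    · refine ⟨-s, by linarith [hs.1], (hlev (-s) (by linarith) _).2 (Or.inr ⟨?_, hz⟩)⟩
      rw [← twoSided_neg h0 (by linarith), neg_neg]
    · exact absurd (by rw [twoSided_of_nonneg le_rfl, hp0]) hz
    · exact ⟨s, hs.2, (hlev s hpos _).2 (Or.inl (twoSided_of_nonneg hpos.le))⟩

end twoSided

namespace CreatesTwoSidedCurve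

variable {c z : ℂ} {γ : ℝ → ℂ} {T : ℝ}

/-- The hull at time `T` gives `z = γ s` with `|s| ≤ T`. The hull at time `|s|` contains it as well,
so uniqueness of the blow-up time forces `|s| = T`. -/
theorem eq_or_eq_of_blowsUpAt (h : CreatesTwoSidedCurve (linearDriver c) γ)
    (hb : BlowsUpAt (linearDriver c) z T) : z = γ T ∨ z = γ (-T) := by
  have hz : z ∈ leftHull (linearDriver c) T := mem_leftHull_iff.2 ⟨T, le_rfl, hb⟩
  rw [h.hull T hb.nonneg] at hz
  obtain ⟨s, hs, rfl⟩ := hz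
  have habs : |s| ≤ T := abs_le.2 hs
  have hmem : γ s ∈ leftHull (linearDriver c) |s| := by
    rw [h.hull _ (abs_nonneg s)]
    exact ⟨s, ⟨neg_abs_le s, le_abs_self s⟩, rfl⟩
  obtain ⟨S, hS, hbS⟩ := mem_leftHull_iff.1 hmem
  have : |s| = T := le_antisymm habs (hb.unique hbS ▸ hS)
  rcases abs_choice s with h' | h'
  · left; rw [← this, h']
  · right; rw [← this, h', neg_neg]

/-- If `γ s` were swallowed at some `S < |s|`, the hull at time `S` would give an earlier visit of
`γ` to this point. -/
theorem blowsUpAt_of_forall_ne (h : CreatesTwoSidedCurve (linearDriver c) γ) {s : ℝ}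
    (hne : ∀ r, |r| < |s| → γ r ≠ γ s) : BlowsUpAt (linearDriver c) (γ s) |s| := by
  have hmem : γ s ∈ leftHull (linearDriver c) |s| := by
    rw [h.hull _ (abs_nonneg s)]
    exact ⟨s, ⟨neg_abs_le s, le_abs_self s⟩, rfl⟩
  obtain ⟨S, hS, hbS⟩ := mem_leftHull_iff.1 hmem
  rcases hS.eq_or_lt with rfl | hlt
  · exact hbS
  · exfalso
    have hz : γ s ∈ leftHull (linearDriver c) S := mem_leftHull_iff.2 ⟨S, le_rfl, hbS⟩
    rw [h.hull S hbS.nonneg] at hz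
    obtain ⟨r, hr, hrs⟩ := hz
    exact hne r ((abs_le.2 hr).trans_lt hlt) hrs

theorem blowsUpAt_of_injective (h : CreatesTwoSidedCurve (linearDriver c) γ)
    (hinj : Function.Injective γ) (s : ℝ) : BlowsUpAt (linearDriver c) (γ s) |s| :=
  h.blowsUpAt_of_forall_ne fun r hr hrs => by
    rw [hinj hrs] at hr
    exact lt_irrefl _ hr

end CreatesTwoSidedCurve

namespace IsExoticCurve

variable {c : ℂ} {γ : ℝ → ℂ} {T t : ℝ}

/-- After the negative end has come to rest, only one point is swallowed at a time. -/
theorem eq_of_blowsUpAt (h : IsExoticCurve (linearDriver c) γ T) (ht : T ≤ t) {z : ℂ}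
    (hb : BlowsUpAt (linearDriver c) z t) : z = γ t := by
  have hT : 0 < T := by linarith [h.jordan.lt]
  rcases h.creates.eq_or_eq_of_blowsUpAt hb with hz | hz
  · exact hz
  · rw [h.stops _ (by linarith)] at hz
    have := hb.unique (blowsUpAt_zero_iff.2 hz)
    linarith

/-- Before the Jordan curve is closed, two points are swallowed at a time. -/
theorem blowsUpAt_pair (h : IsExoticCurve (linearDriver c) γ T) (ht : 0 < t) (htT : t < T) :
    BlowsUpAt (linearDriver c) (γ t) t ∧ BlowsUpAt (linearDriver c) (γ (-t)) t ∧
      γ t ≠ γ (-t) := by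
  have h0 : γ 0 = 0 := h.jordan.right
  have cross : ∀ r s : ℝ, 0 ≤ r → s ≤ 0 → γ r = γ s → γ r = 0 := fun r s hr hs hrs => by
    have : γ r ∈ γ '' Ici 0 ∩ γ '' Iic 0 := ⟨⟨r, hr, rfl⟩, ⟨s, hs, hrs.symm⟩⟩
    rw [h.inter] at this
    exact this
  have pos : γ t ≠ 0 := fun hz => by
    have := h.pos_injOn (mem_Ici.2 ht.le) (mem_Ici.2 le_rfl) (hz.trans h0.symm)
    exact ht.ne' this
  have neg : γ (-t) ≠ 0 := fun hz => by
    have := h.jordan.injOn (x₁ := -t) (x₂ := 0) ⟨by linarith, by linarith⟩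
      ⟨by linarith, le_rfl⟩ (hz.trans h0.symm)
    linarith
  refine ⟨?_, ?_, fun he => pos (cross t (-t) ht.le (by linarith) he)⟩
  · have := h.creates.blowsUpAt_of_forall_ne (s := t) fun r hr hrs => by
      rw [abs_of_pos ht] at hr
      rcases le_total 0 r with h' | h'
      · have := h.pos_injOn (mem_Ici.2 h') (mem_Ici.2 ht.le) hrs
        exact absurd (abs_of_nonneg h') (by linarith)
      · exact pos (cross t r ht.le h' hrs.symm)
    rwa [abs_of_pos ht] at this
  · have := h.creates.blowsUpAt_of_forall_ne (s := -t) fun r hr hrs => by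
      rw [abs_neg, abs_of_pos ht] at hr
      rcases le_total 0 r with h' | h'
      · exact neg (hrs ▸ cross r (-t) h' (by linarith) hrs)
      · have hr' := abs_lt.1 hr
        have := h.jordan.injOn (x₁ := r) (x₂ := -t) ⟨by linarith, h'⟩
          ⟨by linarith, by linarith⟩ hrs
        linarith
    rwa [abs_neg, abs_of_pos ht] at this

end IsExoticCurve

/-! ### Curves made of two trajectories that live forever. -/

/-- Two different trajectories of the reversed Loewner equation which exist for all times. -/
structure IsBranchPair (c : ℂ) (γp γm : ℝ → ℂ) : Prop where
  pos : ∀ T, IsReverseTrajectory c T γp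
  neg : ∀ T, IsReverseTrajectory c T γm
  ne : ∀ s > 0, γp s ≠ γm s

theorem continuousOn_Ici_of_forall_Icc {f : ℝ → ℂ} (h : ∀ T, ContinuousOn f (Icc 0 T)) :
    ContinuousOn f (Ici 0) := fun s hs =>
  (h (s + 1) s ⟨hs, by linarith⟩).mono_of_mem_nhdsWithin
    (mem_of_superset (inter_mem_nhdsWithin _ (Iio_mem_nhds (lt_add_one s)))
      fun _ ht => ⟨ht.1, ht.2.le⟩)

namespace IsBranchPair

variable {c : ℂ} {γp γm γ : ℝ → ℂ}

theorem blowsUpAt_iff (h : IsBranchPair c γp γm) {T : ℝ} (hT : 0 < T) (z : ℂ) :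
    BlowsUpAt (linearDriver c) z T ↔ z = γp T ∨ z = γm T := by
  constructor
  · intro hb
    obtain ⟨hT0, -⟩ | ⟨-, y, hy, rfl⟩ := blowsUpAt_linearDriver_iff.1 hb
    · exact absurd hT0 hT.ne'
    have hTm : T ∈ Ioc 0 T := right_mem_Ioc.2 hT
    rcases hy.eqOn_or_eqOn_or_eqOn (h.pos T) (h.neg T) hT with e | e | e
    · exact Or.inl (e hTm)
    · exact Or.inr (e hTm)
    · exact absurd (e hTm) (h.ne T hT)
  · rintro (rfl | rfl)
    · exact (h.pos T).blowsUpAt hT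
    · exact (h.neg T).blowsUpAt hT

theorem creates (h : IsBranchPair c γp γm) :
    CreatesTwoSidedCurve (linearDriver c) (twoSided γp γm) := by
  refine createsTwoSidedCurve_twoSided (h.pos 0).start (h.neg 0).start
    (continuousOn_Ici_of_forall_Icc fun T => (h.pos T).continuousOn)
    (continuousOn_Ici_of_forall_Icc fun T => (h.neg T).continuousOn) fun T hT z => ?_
  rw [h.blowsUpAt_iff hT]
  refine or_congr_right ⟨fun hz => ⟨hz, ?_⟩, fun hz => hz.1⟩
  rw [hz]
  exact (h.neg T).ne_zero T (right_mem_Ioc.2 hT)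

theorem twoSided_neg (h : IsBranchPair c γp γm) {t : ℝ} (ht : 0 ≤ t) :
    twoSided γp γm (-t) = γm t :=
  _root_.twoSided_neg ((h.pos 0).start.trans (h.neg 0).start.symm) ht

/-- The blow-up time of a point recovers `|s|`, and distinctness of the branches separates `s` from
`-s`. -/
theorem injective (h : IsBranchPair c γp γm) : Function.Injective (twoSided γp γm) := by
  have hb : ∀ s, BlowsUpAt (linearDriver c) (twoSided γp γm s) |s| := by
    intro s
    rcases lt_trichotomy s 0 with hs | rfl | hs
    · rw [abs_of_neg hs, h.blowsUpAt_iff (by linarith)]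
      right
      rw [← h.twoSided_neg (by linarith), neg_neg]
    · rw [abs_zero, blowsUpAt_zero_iff, twoSided_of_nonneg le_rfl, (h.pos 0).start]
    · rw [abs_of_pos hs, h.blowsUpAt_iff hs]
      exact Or.inl (twoSided_of_nonneg hs.le)
  have aux : ∀ s > 0, twoSided γp γm s ≠ twoSided γp γm (-s) := fun s hs => by
    rw [twoSided_of_nonneg hs.le, h.twoSided_neg hs.le]
    exact h.ne s hs
  intro s t hst
  have habs : |s| = |t| := (hb s).unique (hst ▸ hb t)
  rcases abs_eq_abs.1 habs with h' | h'
  · exact h'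
  · rcases lt_trichotomy t 0 with ht | ht | ht
    · subst h'
      have := aux (-t) (by linarith)
      rw [neg_neg] at this
      exact absurd hst this
    · rw [h', ht, neg_zero]
    · subst h'
      exact absurd hst.symm (aux t ht)

/-- Up to orientation, only one injective two-sided curve is created. -/
theorem eq_or_eq_of_injective (h : IsBranchPair c γp γm)
    (hγ : CreatesTwoSidedCurve (linearDriver c) γ) (hinj : Function.Injective γ) :
    (∀ t, 0 ≤ t → γ t = γp t ∧ γ (-t) = γm t) ∨ (∀ t, 0 ≤ t → γ t = γm t ∧ γ (-t) = γp t) := by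
  have hb : ∀ s, BlowsUpAt (linearDriver c) (γ s) |s| := hγ.blowsUpAt_of_injective hinj
  have hp : ∀ t > 0, γ t = γp t ∨ γ t = γm t := fun t ht =>
    (h.blowsUpAt_iff ht _).1 (by simpa [abs_of_pos ht] using hb t)
  have hm : ∀ t > 0, γ (-t) = γp t ∨ γ (-t) = γm t := fun t ht =>
    (h.blowsUpAt_iff ht _).1 (by simpa [abs_of_pos ht] using hb (-t))
  have hne : ∀ t > 0, γ t ≠ γ (-t) := fun t ht he => by have := hinj he; linarith
  have hγ0 : γ 0 = 0 := by simpa [linearDriver] using hγ.start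
  have cp : ContinuousOn γp (Ioi 0) :=
    (continuousOn_Ici_of_forall_Icc fun T => (h.pos T).continuousOn).mono Ioi_subset_Ici_self
  have cm : ContinuousOn γm (Ioi 0) :=
    (continuousOn_Ici_of_forall_Icc fun T => (h.neg T).continuousOn).mono Ioi_subset_Ici_self
  have cγ : ContinuousOn γ (Ioi 0) := hγ.continuous.continuousOn
  have dich : (∀ t > 0, γ t = γp t) ∨ (∀ t > 0, γ t = γm t) := by
    -- At each time `γ` is on one of the two branches. The function `f` is negative on one, positive
    -- on the other and never zero, so `γ` cannot switch.
    set f : ℝ → ℝ := fun t => ‖γ t - γp t‖ - ‖γ t - γm t‖ with hf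
    have cf : ContinuousOn f (Ioi 0) := (cγ.sub cp).norm.sub (cγ.sub cm).norm
    have fne : ∀ t > 0, f t ≠ 0 := fun t ht h0 => by
      rcases hp t ht with e | e
      · simp only [hf, e, sub_self, norm_zero, zero_sub, neg_eq_zero, norm_eq_zero] at h0
        exact h.ne t ht (sub_eq_zero.1 h0)
      · simp only [hf, e, sub_self, norm_zero, sub_zero, norm_eq_zero] at h0
        exact h.ne t ht (sub_eq_zero.1 h0).symm
    have fp : ∀ t > 0, γ t = γp t → f t ≤ 0 := fun t ht e => by simp [hf, e]
    have fm : ∀ t > 0, γ t = γm t → 0 ≤ f t := fun t ht e => by simp [hf, e]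
    by_contra hcon
    push Not at hcon
    obtain ⟨⟨t, ht, htn⟩, ⟨u, hu, hun⟩⟩ := hcon
    obtain ⟨r, hr, hr0⟩ := isPreconnected_Ioi.intermediate_value (mem_Ioi.2 hu) (mem_Ioi.2 ht) cf
      ⟨fp u hu ((hp u hu).resolve_right hun), fm t ht ((hp t ht).resolve_left htn)⟩
    exact fne r hr hr0
  rcases dich with e | e
  · left
    intro t ht
    rcases ht.eq_or_lt with rfl | ht
    · simp [hγ0, (h.pos 0).start, (h.neg 0).start]
    · exact ⟨e t ht, (hm t ht).resolve_left fun h' => hne t ht ((e t ht).trans h'.symm)⟩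
  · right
    intro t ht
    rcases ht.eq_or_lt with rfl | ht
    · simp [hγ0, (h.pos 0).start, (h.neg 0).start]
    · exact ⟨e t ht, (hm t ht).resolve_right fun h' => hne t ht ((e t ht).trans h'.symm)⟩

/-- At its closing time an exotic curve swallows a single point, whereas a branch pair always
swallows two. -/
theorem not_isExoticCurve (h : IsBranchPair c γp γm) {T : ℝ} :
    ¬ IsExoticCurve (linearDriver c) γ T := by
  intro hex
  have hT : 0 < T := by linarith [hex.jordan.lt]
  have h1 := hex.eq_of_blowsUpAt le_rfl ((h.blowsUpAt_iff hT _).2 (Or.inl rfl))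
  have h2 := hex.eq_of_blowsUpAt le_rfl ((h.blowsUpAt_iff hT _).2 (Or.inr rfl))
  exact h.ne T hT (h1.trans h2.symm)

end IsBranchPair

/-! ### Curves with one trajectory that returns to the singularity. -/

/-- A trajectory which exists for all times, and a different one which returns to the
singularity at time `S` and is continued by `0`. -/
structure IsLoopPair (c : ℂ) (γp γm : ℝ → ℂ) (S : ℝ) : Prop where
  time_pos : 0 < S
  pos : ∀ T, IsReverseTrajectory c T γp
  neg : ∀ T < S, IsReverseTrajectory c T γm
  neg_continuousOn : ContinuousOn γm (Ici 0)
  rests : ∀ s ≥ S, γm s = 0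
  ne : ∀ s ∈ Ioo 0 S, γp s ≠ γm s

namespace IsLoopPair

variable {c : ℂ} {γp γm γ : ℝ → ℂ} {S T : ℝ}

theorem neg_zero (h : IsLoopPair c γp γm S) : γm 0 = 0 := (h.neg 0 h.time_pos).start

theorem blowsUpAt_iff_of_lt (h : IsLoopPair c γp γm S) (hT : 0 < T) (hTS : T < S) (z : ℂ) :
    BlowsUpAt (linearDriver c) z T ↔ z = γp T ∨ z = γm T := by
  constructor
  · intro hb
    obtain ⟨hT0, -⟩ | ⟨-, y, hy, rfl⟩ := blowsUpAt_linearDriver_iff.1 hb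
    · exact absurd hT0 hT.ne'
    have hTm : T ∈ Ioc 0 T := right_mem_Ioc.2 hT
    rcases hy.eqOn_or_eqOn_or_eqOn (h.pos T) (h.neg T hTS) hT with e | e | e
    · exact Or.inl (e hTm)
    · exact Or.inr (e hTm)
    · exact absurd (e hTm) (h.ne T ⟨hT, hTS⟩)
  · rintro (rfl | rfl)
    · exact (h.pos T).blowsUpAt hT
    · exact (h.neg T hTS).blowsUpAt hT

/-- A trajectory that lives up to `T ≥ S` cannot follow `γm` all the way to time `S`, since
continuity would bring it back to `0` there. It therefore meets `γp` before `S` and stays with it.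
-/
theorem blowsUpAt_iff_of_ge (h : IsLoopPair c γp γm S) (hTS : S ≤ T) (z : ℂ) :
    BlowsUpAt (linearDriver c) z T ↔ z = γp T := by
  have hS := h.time_pos
  have hT : 0 < T := hS.trans_le hTS
  refine ⟨fun hb => ?_, fun hz => hz ▸ (h.pos T).blowsUpAt hT⟩
  obtain ⟨hT0, -⟩ | ⟨-, y, hy, rfl⟩ := blowsUpAt_linearDriver_iff.1 hb
  · exact absurd hT0 hT.ne'
  have alt : ∀ r ∈ Ioo 0 S, y r = γp r ∨ EqOn y γm (Ioc 0 r) := fun r hr => by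
    have hrm : r ∈ Ioc 0 r := right_mem_Ioc.2 hr.1
    rcases (hy.mono (hr.2.le.trans hTS)).eqOn_or_eqOn_or_eqOn (h.pos r) (h.neg r hr.2) hr.1
      with e | e | e
    · exact Or.inl (e hrm)
    · exact Or.inr e
    · exact absurd (e hrm) (h.ne r hr)
  by_cases hex : ∃ r ∈ Ioo 0 S, y r = γp r
  · obtain ⟨r, hr, e⟩ := hex
    exact hy.eqOn_of_eq (h.pos T) ⟨hr.1, hr.2.le.trans hTS⟩ e (right_mem_Ioc.2 hT)
  · exfalso
    have hall : EqOn y γm (Ioo 0 S) := fun r hr =>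
      ((alt r hr).resolve_left fun e => hex ⟨r, hr, e⟩) (right_mem_Ioc.2 hr.1)
    have hsub : Icc 0 S ⊆ Icc 0 T := Icc_subset_Icc_right hTS
    have hcl : EqOn y γm (Icc 0 S) := by
      have := hall.of_subset_closure (hy.continuousOn.mono hsub)
        (h.neg_continuousOn.mono Icc_subset_Ici_self) Ioo_subset_Icc_self
        (by rw [closure_Ioo hS.ne])
      exact this
    exact hy.ne_zero S ⟨hS, hTS⟩ ((hcl (right_mem_Icc.2 hS.le)).trans (h.rests S le_rfl))

theorem creates (h : IsLoopPair c γp γm S) :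
    CreatesTwoSidedCurve (linearDriver c) (twoSided γp γm) := by
  refine createsTwoSidedCurve_twoSided (h.pos 0).start h.neg_zero
    (continuousOn_Ici_of_forall_Icc fun T => (h.pos T).continuousOn)
    h.neg_continuousOn fun T hT z => ?_
  rcases lt_or_ge T S with hTS | hTS
  · rw [h.blowsUpAt_iff_of_lt hT hTS]
    refine or_congr_right ⟨fun hz => ⟨hz, ?_⟩, fun hz => hz.1⟩
    rw [hz]
    exact (h.neg T hTS).ne_zero T (right_mem_Ioc.2 hT)
  · rw [h.blowsUpAt_iff_of_ge hTS]
    refine ⟨Or.inl, fun hz => hz.resolve_right fun ⟨e, hne⟩ => hne ?_⟩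
    rw [e, h.rests T hTS]

theorem not_injective (h : IsLoopPair c γp γm S)
    (hγ : CreatesTwoSidedCurve (linearDriver c) γ) : ¬ Function.Injective γ := by
  intro hinj
  have hS := h.time_pos
  have h1 := hγ.blowsUpAt_of_injective hinj S
  have h2 := hγ.blowsUpAt_of_injective hinj (-S)
  rw [abs_of_pos hS, h.blowsUpAt_iff_of_ge le_rfl] at h1
  rw [abs_neg, abs_of_pos hS, h.blowsUpAt_iff_of_ge le_rfl] at h2
  have := hinj (h1.trans h2.symm)
  linarith

/-- Both `T` and `S` are the time at which the number of swallowed points drops from two to one. -/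
theorem exotic_time_eq (h : IsLoopPair c γp γm S) (hex : IsExoticCurve (linearDriver c) γ T) :
    T = S := by
  have hT : 0 < T := by linarith [hex.jordan.lt]
  rcases lt_trichotomy T S with hlt | heq | hgt
  · exfalso
    have h1 := hex.eq_of_blowsUpAt le_rfl ((h.blowsUpAt_iff_of_lt hT hlt _).2 (Or.inl rfl))
    have h2 := hex.eq_of_blowsUpAt le_rfl ((h.blowsUpAt_iff_of_lt hT hlt _).2 (Or.inr rfl))
    exact h.ne T ⟨hT, hlt⟩ (h1.trans h2.symm)
  · exact heq
  · exfalso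
    obtain ⟨h1, h2, h3⟩ := hex.blowsUpAt_pair h.time_pos hgt
    rw [h.blowsUpAt_iff_of_ge le_rfl] at h1 h2
    exact h3 (h1.trans h2.symm)

theorem pos_blowsUpAt (h : IsLoopPair c γp γm S) {s : ℝ} (hs : 0 ≤ s) :
    BlowsUpAt (linearDriver c) (γp s) s := by
  rcases hs.eq_or_lt with rfl | hs
  · rw [blowsUpAt_zero_iff, (h.pos 0).start]
  · exact (h.pos s).blowsUpAt hs

theorem neg_blowsUpAt (h : IsLoopPair c γp γm S) {s : ℝ} (hs : 0 ≤ s) (hsS : s < S) :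
    BlowsUpAt (linearDriver c) (γm s) s := by
  rcases hs.eq_or_lt with rfl | hs
  · rw [blowsUpAt_zero_iff, h.neg_zero]
  · exact (h.neg s hsS).blowsUpAt hs

theorem pos_injOn (h : IsLoopPair c γp γm S) : InjOn γp (Ici 0) := fun _ hs _ ht hst =>
  (h.pos_blowsUpAt hs).unique (hst ▸ h.pos_blowsUpAt ht)

theorem neg_injOn (h : IsLoopPair c γp γm S) : InjOn γm (Ico 0 S) := fun _ hs _ ht hst =>
  (h.neg_blowsUpAt hs.1 hs.2).unique (hst ▸ h.neg_blowsUpAt ht.1 ht.2)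

theorem eq_zero_of_pos_eq_neg (h : IsLoopPair c γp γm S) {s t : ℝ} (hs : 0 ≤ s) (ht : 0 ≤ t)
    (hst : γp s = γm t) : γp s = 0 := by
  rcases lt_or_ge t S with htS | htS
  · have : s = t := (h.pos_blowsUpAt hs).unique (hst ▸ h.neg_blowsUpAt ht htS)
    subst this
    rcases hs.eq_or_lt with rfl | hpos
    · exact (h.pos 0).start
    · exact absurd hst (h.ne s ⟨hpos, htS⟩)
  · rw [hst, h.rests t htS]

end IsLoopPair

/-! ### The potential: properness and zeros. -/

/-- In the coordinate `ζ = log (1 - c w / 2)`, the centred Loewner flow of the driver `t ↦ c t`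
becomes the translation flow of this function. -/
noncomputable def potential (ζ : ℂ) : ℂ := 1 + ζ - Complex.exp ζ

theorem potential_re (ζ : ℂ) :
    (potential ζ).re = 1 + ζ.re - Real.exp ζ.re * Real.cos ζ.im := by
  simp [potential, Complex.exp_re]

theorem potential_im (ζ : ℂ) : (potential ζ).im = ζ.im - Real.exp ζ.re * Real.sin ζ.im := by
  simp [potential, Complex.exp_im]

theorem potential_zero : potential 0 = 0 := by simp [potential]

theorem potential_conj (ζ : ℂ) : potential (starRingEnd ℂ ζ) = starRingEnd ℂ (potential ζ) := by
  simp [potential, ← Complex.exp_conj]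

theorem potential_add_int (ζ : ℂ) (n : ℤ) :
    potential (ζ + n * (2 * Real.pi * Complex.I)) =
      potential ζ + n * (2 * Real.pi * Complex.I) := by
  have : Complex.exp (ζ + n * (2 * Real.pi * Complex.I)) = Complex.exp ζ :=
    Complex.exp_eq_exp_iff_exists_int.2 ⟨n, rfl⟩
  simp only [potential, this]
  ring

theorem hasStrictDerivAt_potential (ζ : ℂ) :
    HasStrictDerivAt potential (1 - Complex.exp ζ) ζ :=
  ((hasStrictDerivAt_id ζ).const_add 1).sub (Complex.hasStrictDerivAt_exp ζ)

theorem continuous_potential : Continuous potential := by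
  unfold potential; fun_prop

/-- The union of the closed left half-plane and a closed horizontal strip, on which the potential
is proper. -/
def properDomain : Set ℂ := {ζ | ζ.re ≤ 0 ∨ |ζ.im| ≤ 2 * Real.pi}

/-- In the left half-plane the exponential is bounded by `1`. In the strip it outgrows the linear
term, which the bound `1 + x + x ^ 2 / 2 ≤ exp x` makes explicit. -/
theorem exists_norm_le_of_potential (M : ℝ) :
    ∃ C, ∀ ζ ∈ properDomain, ‖potential ζ‖ ≤ M → ‖ζ‖ ≤ C := by
  have hpi := Real.pi_pos
  refine ⟨(M + 2) + (1 + 2 * (2 * Real.pi + M) + 2 * Real.pi), fun ζ hζ hM => ?_⟩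
  have hM0 : 0 ≤ M := (norm_nonneg _).trans hM
  have hexp : ‖Complex.exp ζ‖ = Real.exp ζ.re := Complex.norm_exp ζ
  by_cases hre : ζ.re ≤ 0
  · have h1 : Real.exp ζ.re ≤ 1 := Real.exp_le_one_iff.2 hre
    have h2 : ζ = potential ζ - 1 + Complex.exp ζ := by rw [potential]; ring
    have h3 : ‖ζ‖ ≤ ‖potential ζ‖ + 1 + ‖Complex.exp ζ‖ := by
      calc ‖ζ‖ = ‖potential ζ - 1 + Complex.exp ζ‖ := by rw [← h2]
        _ ≤ ‖potential ζ - 1‖ + ‖Complex.exp ζ‖ := norm_add_le _ _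
        _ ≤ ‖potential ζ‖ + ‖(1 : ℂ)‖ + ‖Complex.exp ζ‖ := by gcongr; exact norm_sub_le _ _
        _ = _ := by simp
    linarith
  · have him : |ζ.im| ≤ 2 * Real.pi := hζ.resolve_left hre
    push Not at hre
    have hn : ‖ζ‖ ≤ |ζ.re| + |ζ.im| := Complex.norm_le_abs_re_add_abs_im ζ
    rw [abs_of_pos hre] at hn
    have h2 : Complex.exp ζ = 1 + ζ - potential ζ := by simp [potential]
    have h3 : Real.exp ζ.re ≤ 1 + ‖ζ‖ + M := by
      calc Real.exp ζ.re = ‖1 + ζ - potential ζ‖ := by rw [← hexp, h2]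
        _ ≤ ‖1 + ζ‖ + ‖potential ζ‖ := norm_sub_le _ _
        _ ≤ ‖(1 : ℂ)‖ + ‖ζ‖ + M := by gcongr; exact norm_add_le _ _
        _ = _ := by simp
    have h4 := Real.quadratic_le_exp_of_nonneg hre.le
    have h5 : ζ.re ^ 2 ≤ 2 * (2 * Real.pi + M) := by linarith
    have h6 : ζ.re ≤ 1 + 2 * (2 * Real.pi + M) := by nlinarith
    linarith

theorem mul_cos_lt_sin {y : ℝ} (h0 : 0 < y) (hpi : y < Real.pi) :
    y * Real.cos y < Real.sin y := by
  have hs := Real.sin_pos_of_pos_of_lt_pi h0 hpi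
  rcases lt_or_ge y (Real.pi / 2) with h | h
  · have hc : 0 < Real.cos y := Real.cos_pos_of_mem_Ioo ⟨by linarith, h⟩
    have := Real.lt_tan h0 h
    rwa [Real.tan_eq_sin_div_cos, lt_div_iff₀ hc] at this
  · have hc : Real.cos y ≤ 0 := Real.cos_nonpos_of_pi_div_two_le_of_le h (by linarith)
    nlinarith

theorem eq_zero_of_potential_eq_zero {ζ : ℂ} (hζ : ζ ∈ properDomain) (h : potential ζ = 0) :
    ζ = 0 := by
  have hre : Real.exp ζ.re * Real.cos ζ.im = 1 + ζ.re := by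
    have := potential_re ζ
    rw [h, Complex.zero_re] at this
    linarith
  have him : Real.exp ζ.re * Real.sin ζ.im = ζ.im := by
    have := potential_im ζ
    rw [h, Complex.zero_im] at this
    linarith
  -- For `y > 0`, the identity for the sine and `sin y < y` force `x > 0` and then `y < π`.
  -- Multiplying `y cos y < sin y` by `exp x` now gives `y (1 + x) < y`, a contradiction. Negative
  -- imaginary parts follow by reflection.
  have key : ∀ x y : ℝ, 0 < y → x ≤ 0 ∨ y ≤ 2 * Real.pi → Real.exp x * Real.cos y = 1 + x →
      Real.exp x * Real.sin y = y → False := by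
    intro x y hy hxy hc hs
    have hsl := Real.sin_lt hy
    have hxpos : 0 < x := by
      by_contra hx
      have h1 : Real.exp x ≤ 1 := Real.exp_le_one_iff.2 (not_lt.1 hx)
      have hsp : 0 < Real.sin y := by
        by_contra hn
        have := mul_nonpos_of_nonneg_of_nonpos (Real.exp_pos x).le (not_lt.1 hn)
        linarith
      nlinarith
    have hy2 : y ≤ 2 * Real.pi := hxy.resolve_left (not_le.2 hxpos)
    have hypi : y < Real.pi := by
      by_contra hn
      have : Real.sin y ≤ 0 := by
        have := Real.sin_nonneg_of_nonneg_of_le_pi (x := 2 * Real.pi - y) (by linarith)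
          (by linarith [not_lt.1 hn])
        rw [Real.sin_two_pi_sub] at this
        linarith
      have := mul_nonpos_of_nonneg_of_nonpos (Real.exp_pos x).le this
      linarith
    have h1 := mul_cos_lt_sin hy hypi
    have h2 := mul_lt_mul_of_pos_left h1 (Real.exp_pos x)
    have h3 : Real.exp x * (y * Real.cos y) = y * (1 + x) := by rw [← hc]; ring
    nlinarith
  have hy0 : ζ.im = 0 := by
    rcases lt_trichotomy ζ.im 0 with hy | hy | hy
    · exfalso
      refine key ζ.re (-ζ.im) (by linarith) ?_ (by rwa [Real.cos_neg])
        (by rw [Real.sin_neg]; linarith)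
      exact hζ.imp_right fun h => (neg_le_abs _).trans h
    · exact hy
    · exact (key ζ.re ζ.im hy (hζ.imp_right fun h => (le_abs_self _).trans h) hre him).elim
  have hx0 : ζ.re = 0 := by
    rw [hy0, Real.cos_zero, mul_one] at hre
    by_contra hne
    have := Real.add_one_lt_exp hne
    linarith
  exact Complex.ext hx0 hy0

/-- Properness confines the lift to a compact set, and every cluster point lies above `potential p`.
This gives limits at critical points, where there is no local inverse. -/
theorem tendsto_of_tendsto_potential {l : Filter ℝ} {ζ : ℝ → ℂ} {p : ℂ} {K : Set ℂ}
    (hK : IsClosed K) (hKp : K ⊆ properDomain) (hζ : ∀ᶠ s in l, ζ s ∈ K)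
    (hlim : Tendsto (fun s => potential (ζ s)) l (𝓝 (potential p)))
    (huniq : ∀ q ∈ K, potential q = potential p → q = p) : Tendsto ζ l (𝓝 p) := by
  obtain ⟨C, hC⟩ := exists_norm_le_of_potential (‖potential p‖ + 1)
  have hcomp : IsCompact (K ∩ Metric.closedBall 0 C) :=
    (isCompact_closedBall 0 C).inter_left hK
  refine hcomp.tendsto_nhds_of_unique_mapClusterPt ?_ fun q hq hcl => huniq q hq.1 ?_
  · have := hlim.norm.eventually_le_const (lt_add_one ‖potential p‖)
    filter_upwards [hζ, this] with s h1 h2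
    exact ⟨h1, by simpa using hC _ (hKp h1) h2⟩
  · have h1 : MapClusterPt (potential q) l (fun s => potential (ζ s)) :=
      hcl.continuousAt_comp continuous_potential.continuousAt
    exact eq_of_nhds_neBot (h1.neBot.mono (inf_le_inf_left _ hlim))

/-! ### Inverse branches of the potential. -/

/-- If a preconnected set `V` meets the image of `D` and `D` has no boundary points above `V`,
then the potential has a continuous inverse `V → D`. -/
theorem exists_inverse_potential {D V : Set ℂ} (hD : IsOpen D)
    (hcrit : ∀ ζ ∈ D, Complex.exp ζ ≠ 1) (hproper : D ⊆ properDomain) (hV : IsPreconnected V)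
    (hcl : ∀ ζ ∈ closure D, potential ζ ∈ V → ζ ∈ D)
    (hinj : InjOn potential (D ∩ potential ⁻¹' V)) (hne : ∃ ζ ∈ D, potential ζ ∈ V) :
    ∃ G : ℂ → ℂ, ContinuousOn G V ∧ ∀ w ∈ V, G w ∈ D ∧ potential (G w) = w := by
  have hnhds : ∀ ζ ∈ D, ∀ N ∈ 𝓝 ζ, potential '' N ∈ 𝓝 (potential ζ) := fun ζ hζ N hN => by
    rw [← (hasStrictDerivAt_potential ζ).map_nhds_eq (sub_ne_zero.2 (hcrit ζ hζ).symm)]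
    exact image_mem_map hN
  have hopen : IsOpen (potential '' D) := by
    rw [isOpen_iff_mem_nhds]
    rintro _ ⟨ζ, hζ, rfl⟩
    exact hnhds ζ hζ D (hD.mem_nhds hζ)
  -- The image of `D` is open, and it is closed relative to `V` by properness and the boundary
  -- condition; connectedness of `V` does the rest.
  have hsub : V ⊆ potential '' D := by
    refine hV.subset_of_closure_inter_subset hopen ?_ ?_
    · obtain ⟨ζ, h1, h2⟩ := hne
      exact ⟨potential ζ, h2, ζ, h1, rfl⟩
    · rintro w ⟨hw, hwV⟩
      obtain ⟨u, hu, hlim⟩ := mem_closure_iff_seq_limit.1 hw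
      choose ζ hζ hζu using hu
      obtain ⟨C, hC⟩ := exists_norm_le_of_potential (‖w‖ + 1)
      have hev : ∀ᶠ n in atTop, ζ n ∈ Metric.closedBall (0 : ℂ) C := by
        filter_upwards [hlim.norm.eventually_le_const (lt_add_one ‖w‖)] with n hn
        rw [mem_closedBall_zero_iff]
        exact hC _ (hproper (hζ n)) (by rw [hζu]; exact hn)
      obtain ⟨z, -, φ, hφ, hz⟩ := (isCompact_closedBall (0 : ℂ) C).tendsto_subseq' hev.frequently
      have hzw : potential z = w := by
        have h1 := (continuous_potential.tendsto z).comp hz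
        have h2 := hlim.comp hφ.tendsto_atTop
        refine tendsto_nhds_unique h1 (h2.congr fun n => ?_)
        simp [hζu]
      have hzcl : z ∈ closure D :=
        mem_closure_of_tendsto hz (Eventually.of_forall fun n => hζ (φ n))
      exact ⟨z, hcl z hzcl (hzw ▸ hwV), hzw⟩
  have hsub' : ∀ w ∈ V, ∃ ζ, ζ ∈ D ∧ potential ζ = w := fun w hw => hsub hw
  choose! G hGD hG using hsub'
  refine ⟨G, fun w hw => ?_, fun w hw => ⟨hGD w hw, hG w hw⟩⟩
  rw [ContinuousWithinAt, tendsto_def]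
  intro N hN
  -- Continuity of `G`: the potential is open on `D`, and injectivity above `V` identifies the
  -- nearby preimages.
  have hmem := hnhds (G w) (hGD w hw) (N ∩ D) (inter_mem hN (hD.mem_nhds (hGD w hw)))
  rw [hG w hw] at hmem
  filter_upwards [mem_nhdsWithin_of_mem_nhds hmem, self_mem_nhdsWithin]
  rintro _ ⟨ζ, hζ, rfl⟩ hv
  have : G (potential ζ) = ζ :=
    hinj ⟨hGD _ hv, by rw [mem_preimage, hG _ hv]; exact hv⟩ ⟨hζ.2, hv⟩ (hG _ hv)
  rw [mem_preimage, this]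
  exact hζ.1

/-- The Noshiro–Warschawski criterion for the potential. -/
theorem injOn_potential_of_convex {D : Set ℂ} (hD : Convex ℝ D) (k : ℂ)
    (hk : ∀ ζ ∈ D, 0 < (k * (1 - Complex.exp ζ)).re) : InjOn potential D := by
  intro z₁ h₁ z₂ h₂ heq
  by_contra hne
  have hΔ : z₂ - z₁ ≠ 0 := sub_ne_zero.2 (Ne.symm hne)
  -- Division by `z₂ - z₁` cancels the direction of the segment, leaving `k` times the derivative of
  -- the potential.
  have hder : ∀ t : ℝ, HasDerivAt (fun t : ℝ => (k / (z₂ - z₁) *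
      potential (z₁ + t * (z₂ - z₁))).re) (k * (1 - Complex.exp (z₁ + t * (z₂ - z₁)))).re t := by
    intro t
    have h1 : HasDerivAt (fun t : ℝ => z₁ + t * (z₂ - z₁)) (1 * (z₂ - z₁)) t :=
      ((hasDerivAt_id t).ofReal_comp.mul_const (z₂ - z₁)).const_add z₁
    have h2 := ((hasStrictDerivAt_potential (z₁ + t * (z₂ - z₁))).hasDerivAt.scomp t h1).const_mul
      (k / (z₂ - z₁))
    have h3 := Complex.reCLM.hasFDerivAt.comp_hasDerivAt t h2
    refine h3.congr_deriv ?_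
    simp only [Complex.reCLM_apply, smul_eq_mul]
    congr 1
    field_simp
  have hmono : StrictMonoOn (fun t : ℝ => (k / (z₂ - z₁) *
      potential (z₁ + t * (z₂ - z₁))).re) (Icc 0 1) := by
    refine strictMonoOn_of_deriv_pos (convex_Icc 0 1)
      (fun t _ => (hder t).continuousAt.continuousWithinAt) fun t ht => ?_
    rw [(hder t).deriv]
    rw [interior_Icc] at ht
    refine hk _ ?_
    have := hD.add_smul_sub_mem h₁ h₂ (t := t) ⟨ht.1.le, ht.2.le⟩
    simpa using this
  have := hmono (left_mem_Icc.2 zero_le_one) (right_mem_Icc.2 zero_le_one) zero_lt_one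
  simp [heq] at this

theorem injOn_potential_re_neg : InjOn potential {ζ | ζ.re < 0} := by
  refine injOn_potential_of_convex (convex_halfSpace_re_lt 0) 1 fun ζ hζ => ?_
  have h1 : Real.exp ζ.re < 1 := Real.exp_lt_one_iff.2 hζ
  have h2 := Real.cos_le_one ζ.im
  have h3 := Real.exp_pos ζ.re
  simp only [one_mul, Complex.sub_re, Complex.one_re, Complex.exp_re]
  nlinarith

theorem injOn_potential_strip_pos : InjOn potential {ζ | 0 < ζ.im ∧ ζ.im < Real.pi} := by
  refine injOn_potential_of_convex
    ((convex_halfSpace_im_gt 0).inter (convex_halfSpace_im_lt Real.pi)) Complex.I fun ζ hζ => ?_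
  have := mul_pos (Real.exp_pos ζ.re) (Real.sin_pos_of_pos_of_lt_pi hζ.1 hζ.2)
  simpa [Complex.exp_im] using this

theorem injOn_potential_strip_neg : InjOn potential {ζ | -Real.pi < ζ.im ∧ ζ.im < 0} := by
  refine injOn_potential_of_convex
    ((convex_halfSpace_im_gt (-Real.pi)).inter (convex_halfSpace_im_lt 0)) (-Complex.I)
    fun ζ hζ => ?_
  have h := Real.sin_neg_of_neg_of_neg_pi_lt hζ.2 hζ.1
  have := mul_neg_of_pos_of_neg (Real.exp_pos ζ.re) h
  simpa [Complex.exp_im] using this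

theorem injOn_potential_strip_top :
    InjOn potential {ζ | Real.pi < ζ.im ∧ ζ.im < 2 * Real.pi} := by
  refine injOn_potential_of_convex
    ((convex_halfSpace_im_gt Real.pi).inter (convex_halfSpace_im_lt (2 * Real.pi)))
    (-Complex.I) fun ζ hζ => ?_
  have h : Real.sin ζ.im < 0 := by
    have := Real.sin_pos_of_pos_of_lt_pi (x := 2 * Real.pi - ζ.im) (by linarith [hζ.2])
      (by linarith [hζ.1])
    rw [Real.sin_two_pi_sub] at this
    linarith
  have := mul_neg_of_pos_of_neg (Real.exp_pos ζ.re) h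
  simpa [Complex.exp_im] using this

theorem injOn_potential_im_pi : InjOn potential {ζ | ζ.im = Real.pi} := by
  refine injOn_potential_of_convex (convex_hyperplane Complex.imLm.isLinear _) 1 fun ζ hζ => ?_
  have h : ζ.im = Real.pi := hζ
  have := Real.exp_pos ζ.re
  simp only [one_mul, Complex.sub_re, Complex.one_re, Complex.exp_re, h, Real.cos_pi]
  linarith

theorem injOn_potential_pos_real : InjOn potential {ζ | ζ.im = 0 ∧ 0 < ζ.re} := by
  refine injOn_potential_of_convex
    ((convex_hyperplane Complex.imLm.isLinear _).inter (convex_halfSpace_re_gt 0)) (-1)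
    fun ζ hζ => ?_
  have h : ζ.im = 0 := hζ.1
  have := Real.one_lt_exp_iff.2 hζ.2
  simp only [neg_mul, one_mul, Complex.neg_re, Complex.sub_re, Complex.one_re, Complex.exp_re, h,
    Real.cos_zero]
  linarith

theorem exp_ne_one_of_re_ne_zero {ζ : ℂ} (h : ζ.re ≠ 0) : Complex.exp ζ ≠ 1 := fun he => by
  have := congrArg norm he
  rw [Complex.norm_exp, norm_one, Real.exp_eq_one_iff] at this
  exact h this

/-- The inverse of the potential with values in the left half-plane. -/
theorem exists_left_inverse_potential : ∃ G : ℂ → ℂ,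
    ContinuousOn G {w | w.re ≤ 0 ∧ ∀ n : ℤ, w ≠ n * (2 * Real.pi * Complex.I)} ∧
    ∀ w ∈ {w : ℂ | w.re ≤ 0 ∧ ∀ n : ℤ, w ≠ n * (2 * Real.pi * Complex.I)},
      G w ∈ {ζ : ℂ | ζ.re < 0} ∧ potential (G w) = w := by
  refine exists_inverse_potential (isOpen_lt Complex.continuous_re continuous_const)
    (fun ζ hζ => exp_ne_one_of_re_ne_zero (ne_of_lt hζ)) (fun ζ hζ => Or.inl (le_of_lt hζ)) ?_
    ?_ (injOn_potential_re_neg.mono inter_subset_left) ?_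
  · refine (convex_halfSpace_re_lt 0).isPreconnected.subset_closure (fun w hw => ?_)
      (fun w hw => ?_)
    · refine ⟨le_of_lt hw, fun n hn => ?_⟩
      have : w.re < 0 := hw
      simp [hn] at this
    · rw [Complex.closure_setOfPred_re_lt]
      exact hw.1
  · intro ζ hζ hV
    rw [Complex.closure_setOfPred_re_lt] at hζ
    -- On the imaginary axis the potential has real part `1 - cos ≥ 0`. Only critical points remain,
    -- and their values are excluded from `V`.
    refine lt_of_le_of_ne (show ζ.re ≤ 0 from hζ) fun h0 => ?_
    have hre := hV.1
    rw [potential_re, h0, Real.exp_zero] at hre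
    have hcos : Real.cos ζ.im = 1 := le_antisymm (Real.cos_le_one _) (by linarith)
    obtain ⟨n, hn⟩ := (Real.cos_eq_one_iff _).1 hcos
    refine hV.2 n ?_
    have : ζ = 0 + n * (2 * Real.pi * Complex.I) := by
      apply Complex.ext
      · simp [h0]
      · simp [← hn]
    rw [this, potential_add_int, potential_zero, zero_add]
  · refine ⟨-1, by simp, ?_, fun n hn => ?_⟩
    · have := Real.exp_pos (-1)
      rw [potential_re]; simp [this.le]
    · have := congrArg Complex.re hn
      have h1 := Real.exp_pos (-1)
      rw [potential_re] at this
      simp at this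

/-- The hypothesis reads `1 + x ≤ exp x * cos y`; together with `y cos y < sin y` it gives `exp x *
sin y > y (1 + x) > y`. -/
theorem im_potential_neg {ζ : ℂ} (hre : 0 < ζ.re) (him : 0 < ζ.im) (hpi : ζ.im < Real.pi)
    (h : (potential ζ).re ≤ 0) : (potential ζ).im < 0 := by
  rw [potential_re] at h
  rw [potential_im]
  have h1 := mul_cos_lt_sin him hpi
  have h2 := mul_lt_mul_of_pos_left h1 (Real.exp_pos ζ.re)
  nlinarith

theorem im_potential_pos {ζ : ℂ} (hre : 0 < ζ.re) (him : ζ.im < 0) (hpi : -Real.pi < ζ.im)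
    (h : (potential ζ).re ≤ 0) : 0 < (potential ζ).im := by
  have := im_potential_neg (ζ := starRingEnd ℂ ζ) (by simpa) (by simpa)
    (by simp; linarith) (by simpa [potential_conj])
  simpa [potential_conj] using this

/-- The inverse of the potential with values in a half-strip to the right. -/
theorem exists_right_inverse_potential : ∃ G : ℂ → ℂ,
    ContinuousOn G {w | w.re ≤ 0 ∧ w ≠ 0} ∧ ∀ w ∈ {w : ℂ | w.re ≤ 0 ∧ w ≠ 0},
      G w ∈ {ζ : ℂ | 0 < ζ.re ∧ |ζ.im| < Real.pi} ∧ potential (G w) = w := by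
  have hpi := Real.pi_pos
  refine exists_inverse_potential ((isOpen_lt continuous_const Complex.continuous_re).inter
      (isOpen_lt Complex.continuous_im.abs continuous_const))
    (fun ζ hζ => exp_ne_one_of_re_ne_zero (ne_of_gt hζ.1))
    (fun ζ hζ => Or.inr (by linarith [hζ.2])) ?_ ?_ ?_ ?_
  · refine (convex_halfSpace_re_lt 0).isPreconnected.subset_closure (fun w hw => ?_)
      (fun w hw => ?_)
    · refine ⟨le_of_lt hw, fun hn => ?_⟩
      have : w.re < 0 := hw
      simp [hn] at this
    · rw [Complex.closure_setOfPred_re_lt]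
      exact hw.1
  · intro ζ hζ hV
    have hζ' : ζ ∈ {ζ : ℂ | 0 ≤ ζ.re ∧ |ζ.im| ≤ Real.pi} := by
      refine closure_minimal (fun z hz => And.intro (le_of_lt hz.1) (le_of_lt hz.2)) ?_ hζ
      exact (isClosed_le continuous_const Complex.continuous_re).inter
        (isClosed_le Complex.continuous_im.abs continuous_const)
    have hV1 := hV.1
    rw [potential_re] at hV1
    -- On the horizontal edges the real part of the potential is `1 + x + exp x > 0`.
    have him : |ζ.im| < Real.pi := by
      refine lt_of_le_of_ne hζ'.2 fun h => ?_
      rw [← Real.cos_abs, h, Real.cos_pi] at hV1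
      have := Real.exp_pos ζ.re
      linarith [hζ'.1]
    refine ⟨lt_of_le_of_ne hζ'.1 fun h0 => ?_, him⟩
    rw [← h0, Real.exp_zero] at hV1
    have hcos : Real.cos ζ.im = 1 := le_antisymm (Real.cos_le_one _) (by linarith)
    have habs := abs_lt.1 him
    have hy : ζ.im = 0 :=
      (Real.cos_eq_one_iff_of_lt_of_lt (by linarith) (by linarith)).1 hcos
    exact hV.2 (by rw [show ζ = 0 from Complex.ext h0.symm hy, potential_zero])
  · rintro z ⟨⟨hz1, hz2⟩, hz3, -⟩ w ⟨⟨hw1, hw2⟩, hw3, -⟩ heq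
    have az := abs_lt.1 hz2
    have aw := abs_lt.1 hw2
    -- The convexity criterion applies only to pieces of the half-strip. The sign of the imaginary
    -- part of the value tells which piece contains the preimage.
    have trich : ∀ ζ : ℂ, 0 < ζ.re → |ζ.im| < Real.pi → (potential ζ).re ≤ 0 →
        (ζ.im < 0 ∧ 0 < (potential ζ).im) ∨ (ζ.im = 0 ∧ (potential ζ).im = 0) ∨
        (0 < ζ.im ∧ (potential ζ).im < 0) := by
      intro ζ h1 h2 h3
      have h2' := abs_lt.1 h2
      rcases lt_trichotomy ζ.im 0 with h | h | h
      · exact Or.inl ⟨h, im_potential_pos h1 h h2'.1 h3⟩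
      · exact Or.inr (Or.inl ⟨h, by rw [potential_im, h]; simp⟩)
      · exact Or.inr (Or.inr ⟨h, im_potential_neg h1 h h2'.2 h3⟩)
    have tz := trich z hz1 hz2 hz3
    have tw := trich w hw1 hw2 hw3
    rw [← heq] at tw
    rcases tz with ⟨a, a'⟩ | ⟨a, a'⟩ | ⟨a, a'⟩ <;> rcases tw with ⟨b, b'⟩ | ⟨b, b'⟩ | ⟨b, b'⟩ <;>
      try (exfalso; linarith)
    · exact injOn_potential_strip_neg ⟨az.1, a⟩ ⟨aw.1, b⟩ heq
    · exact injOn_potential_pos_real ⟨a, hz1⟩ ⟨b, hw1⟩ heq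
    · exact injOn_potential_strip_pos ⟨a, az.2⟩ ⟨b, aw.2⟩ heq
  · have hneg : (potential 1).re < 0 := by
      rw [potential_re]
      have := Real.exp_one_gt_d9
      simp only [Complex.one_re, Complex.one_im, Real.cos_zero, mul_one]
      linarith
    refine ⟨1, ⟨by simp, by simpa using hpi⟩, hneg.le, fun h0 => ?_⟩
    rw [h0] at hneg
    simp at hneg

/-- The inverse of the potential with values in the strip between two critical points. -/
theorem exists_upper_inverse_potential : ∃ G : ℂ → ℂ,
    ContinuousOn G {w | 0 < w.re} ∧ ∀ w ∈ {w : ℂ | 0 < w.re},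
      G w ∈ {ζ : ℂ | 0 < ζ.im ∧ ζ.im < 2 * Real.pi} ∧ potential (G w) = w := by
  have hpi := Real.pi_pos
  refine exists_inverse_potential ((isOpen_lt continuous_const Complex.continuous_im).inter
      (isOpen_lt Complex.continuous_im continuous_const)) (fun ζ hζ h1 => ?_)
    (fun ζ hζ => Or.inr (by rw [abs_of_pos hζ.1]; exact hζ.2.le))
    (convex_halfSpace_re_gt 0).isPreconnected ?_ ?_ ?_
  · obtain ⟨n, hn⟩ := Complex.exp_eq_one_iff.1 h1
    have him : ζ.im = n * (2 * Real.pi) := by rw [hn]; simp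
    have h0 : (0 : ℝ) < n := by
      by_contra hcon
      have := mul_nonpos_of_nonpos_of_nonneg (not_lt.1 hcon) (by positivity : 0 ≤ 2 * Real.pi)
      linarith [hζ.1]
    have h2 : (n : ℝ) < 1 := by
      by_contra hcon
      have := mul_le_mul_of_nonneg_right (not_lt.1 hcon) (by positivity : 0 ≤ 2 * Real.pi)
      linarith [hζ.2]
    have h0' : (0 : ℤ) < n := by exact_mod_cast h0
    have h2' : n < (1 : ℤ) := by exact_mod_cast h2
    omega
  · intro ζ hζ hV
    have hζ' : ζ ∈ {ζ : ℂ | 0 ≤ ζ.im ∧ ζ.im ≤ 2 * Real.pi} := by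
      refine closure_minimal (fun z hz => And.intro (le_of_lt hz.1) (le_of_lt hz.2)) ?_ hζ
      exact (isClosed_le continuous_const Complex.continuous_im).inter
        (isClosed_le Complex.continuous_im continuous_const)
    have hV1 : 0 < (potential ζ).re := hV
    rw [potential_re] at hV1
    -- On both edges of the strip the real part of the potential is `1 + x - exp x ≤ 0`.
    have hexp := Real.add_one_le_exp ζ.re
    refine ⟨lt_of_le_of_ne hζ'.1 fun h => ?_, lt_of_le_of_ne hζ'.2 fun h => ?_⟩
    · rw [← h, Real.cos_zero] at hV1
      linarith
    · rw [h, Real.cos_two_pi] at hV1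
      linarith
  · rintro z ⟨⟨hz1, hz2⟩, -⟩ w ⟨⟨hw1, hw2⟩, -⟩ heq
    -- The strip is cut along `Im ζ = π`, and comparing the imaginary part of the value with `π`
    -- identifies the piece.
    have trich : ∀ ζ : ℂ, 0 < ζ.im → ζ.im < 2 * Real.pi →
        (ζ.im < Real.pi ∧ (potential ζ).im < Real.pi) ∨
        (ζ.im = Real.pi ∧ (potential ζ).im = Real.pi) ∨
        (Real.pi < ζ.im ∧ Real.pi < (potential ζ).im) := by
      intro ζ h1 h2
      rw [potential_im]
      have he := Real.exp_pos ζ.re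
      rcases lt_trichotomy ζ.im Real.pi with h | h | h
      · have := mul_pos he (Real.sin_pos_of_pos_of_lt_pi h1 h)
        exact Or.inl ⟨h, by linarith⟩
      · exact Or.inr (Or.inl ⟨h, by rw [h]; simp⟩)
      · have hs := Real.sin_pos_of_pos_of_lt_pi (x := 2 * Real.pi - ζ.im) (by linarith)
          (by linarith)
        rw [Real.sin_two_pi_sub] at hs
        have := mul_pos he hs
        exact Or.inr (Or.inr ⟨h, by linarith⟩)
    have tz := trich z hz1 hz2
    have tw := trich w hw1 hw2
    rw [← heq] at tw
    rcases tz with ⟨a, a'⟩ | ⟨a, a'⟩ | ⟨a, a'⟩ <;> rcases tw with ⟨b, b'⟩ | ⟨b, b'⟩ | ⟨b, b'⟩ <;>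
      try (exfalso; linarith)
    · exact injOn_potential_strip_pos ⟨hz1, a⟩ ⟨hw1, b⟩ heq
    · exact injOn_potential_im_pi a b heq
    · exact injOn_potential_strip_top ⟨a, hz2⟩ ⟨b, hw2⟩ heq
  · refine ⟨Real.pi * Complex.I, ⟨by simpa using hpi, by simp; linarith⟩, ?_⟩
    change 0 < (potential _).re
    rw [potential_re]
    simp

/-! ### Lifts of rays and the trajectories they give. -/

/-- The lift of the ray `s ↦ a s` by an inverse `G` of the potential, started at `0`. -/
noncomputable def rayLift (G : ℂ → ℂ) (a : ℂ) (s : ℝ) : ℂ := if s = 0 then 0 else G (a * s)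

theorem rayLift_zero (G : ℂ → ℂ) (a : ℂ) : rayLift G a 0 = 0 := if_pos rfl

theorem rayLift_of_pos (G : ℂ → ℂ) (a : ℂ) {s : ℝ} (hs : 0 < s) : rayLift G a s = G (a * s) :=
  if_neg hs.ne'

theorem isClosed_properDomain : IsClosed properDomain :=
  (isClosed_le Complex.continuous_re continuous_const).union
    (isClosed_le Complex.continuous_im.abs continuous_const)

theorem continuousOn_rayLift {G : ℂ → ℂ} {V K : Set ℂ} {a : ℂ} {S : ℝ} (hG : ContinuousOn G V)
    (hGK : ∀ w ∈ V, G w ∈ K ∧ potential (G w) = w) (hK : K ⊆ properDomain)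
    (hray : ∀ s ∈ Ioo 0 S, a * (s : ℂ) ∈ V) : ContinuousOn (rayLift G a) (Ico 0 S) := by
  have hmul : Continuous fun s : ℝ => a * (s : ℂ) := by fun_prop
  have hpos : ContinuousOn (rayLift G a) (Ioo 0 S) :=
    (hG.comp hmul.continuousOn hray).congr fun s hs => rayLift_of_pos G a hs.1
  intro s hs
  rcases hs.1.eq_or_lt with rfl | h0
  · rw [← Ioo_insert_left hs.2, continuousWithinAt_insert_self, ContinuousWithinAt, rayLift_zero]
    -- The start `0` is a critical value, so continuity there comes from properness and from `0`
    -- being the only zero in `properDomain`.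
    refine tendsto_of_tendsto_potential isClosed_properDomain subset_rfl
      (eventually_of_mem self_mem_nhdsWithin fun s hs => ?_) ?_ fun q hq h => ?_
    · rw [rayLift_of_pos G a hs.1]
      exact hK (hGK _ (hray s hs)).1
    · have : Tendsto (fun s : ℝ => a * (s : ℂ)) (𝓝[Ioo 0 S] 0) (𝓝 (potential 0)) := by
        rw [potential_zero]
        simpa using (hmul.tendsto 0).mono_left nhdsWithin_le_nhds
      refine this.congr' (eventually_of_mem self_mem_nhdsWithin fun s hs => ?_)
      simp only [rayLift_of_pos G a hs.1, (hGK _ (hray s hs)).2]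
    · exact eq_zero_of_potential_eq_zero hq (h.trans potential_zero)
  · exact (hpos.continuousAt (Ioo_mem_nhds h0 hs.2)).continuousWithinAt

/-- The point of the `z`-plane with coordinate `ζ = log (1 - c z / 2)`. -/
noncomputable def ofLog (c ζ : ℂ) : ℂ := 2 / c * (1 - Complex.exp ζ)

theorem continuous_ofLog (c : ℂ) : Continuous (ofLog c) := by unfold ofLog; fun_prop

theorem one_sub_ofLog {c : ℂ} (hc : c ≠ 0) (ζ : ℂ) : 1 - c * ofLog c ζ / 2 = Complex.exp ζ := by
  rw [ofLog]; field_simp; ring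

theorem ofLog_eq_zero_iff {c : ℂ} (hc : c ≠ 0) {ζ : ℂ} : ofLog c ζ = 0 ↔ Complex.exp ζ = 1 := by
  rw [ofLog, mul_eq_zero, or_iff_right (div_ne_zero two_ne_zero hc), sub_eq_zero, eq_comm]

theorem ofLog_sub {c : ℂ} (ζ : ℂ) : ofLog c ζ - 2 / c = -(2 / c) * Complex.exp ζ := by
  rw [ofLog]; ring

theorem ofLog_ne {c : ℂ} (hc : c ≠ 0) (ζ : ℂ) : ofLog c ζ ≠ 2 / c := by
  rw [← sub_ne_zero, ofLog_sub]
  simp [hc, Complex.exp_ne_zero]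

theorem exp_eq_exp_of_ofLog_eq {c : ℂ} (hc : c ≠ 0) {ζ ξ : ℂ} (h : ofLog c ζ = ofLog c ξ) :
    Complex.exp ζ = Complex.exp ξ := by
  rw [← one_sub_ofLog hc, ← one_sub_ofLog hc, h]

/-- Continuity keeps `ζ` on the local inverse through `ζ s`, so the inverse function theorem gives
the derivative. -/
theorem hasDerivAt_of_potential_eq {a : ℂ} {ζ : ℝ → ℂ} {s : ℝ} (hζ : ContinuousAt ζ s)
    (hpot : ∀ᶠ t in 𝓝 s, potential (ζ t) = a * (t : ℂ)) (hreg : Complex.exp (ζ s) ≠ 1) :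
    HasDerivAt ζ (a / (1 - Complex.exp (ζ s))) s := by
  have hd := hasStrictDerivAt_potential (ζ s)
  have hne : 1 - Complex.exp (ζ s) ≠ 0 := sub_ne_zero.2 hreg.symm
  have hinv := (hd.to_localInverse hne).hasDerivAt
  rw [hpot.self_of_nhds] at hinv
  have hlin : HasDerivAt (fun t : ℝ => a * (t : ℂ)) (a * ((1 : ℝ) : ℂ)) s :=
    (hasDerivAt_id s).ofReal_comp.const_mul a
  have hcomp := hinv.scomp s hlin
  refine (hcomp.congr_of_eventuallyEq ?_).congr_deriv ?_
  · have hleft := hζ.eventually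
      ((hd.hasStrictFDerivAt_equiv hne).eventually_left_inverse)
    filter_upwards [hleft, hpot] with t h1 h2
    rw [Function.comp_apply, ← h2]
    exact h1.symm
  · simp [div_eq_mul_inv]

/-- With `y = (2 / c) (1 - exp ζ)` and `ζ' = (c ^ 2 / 2) / (1 - exp ζ)` one finds `y' = -c exp ζ /
(1 - exp ζ) = c - 2 / y`. -/
theorem isReverseTrajectory_ofLog {c : ℂ} (hc : c ≠ 0) {ζ : ℝ → ℂ} {S T : ℝ} (h0 : ζ 0 = 0)
    (hcont : ContinuousOn ζ (Ico 0 S))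
    (hpot : ∀ s ∈ Ioo 0 S, potential (ζ s) = c ^ 2 / 2 * (s : ℂ))
    (hreg : ∀ s ∈ Ioo 0 S, Complex.exp (ζ s) ≠ 1) (hT : T < S) :
    IsReverseTrajectory c T (fun s => ofLog c (ζ s)) where
  start := by simp [ofLog, h0]
  continuousOn := (continuous_ofLog c).comp_continuousOn
    (hcont.mono fun s hs => ⟨hs.1, hs.2.trans_lt hT⟩)
  ne_zero s hs := fun h => hreg s ⟨hs.1, hs.2.trans_lt hT⟩ ((ofLog_eq_zero_iff hc).1 h)
  hasDeriv s hs := by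
    have hs' : s ∈ Ioo 0 S := ⟨hs.1, hs.2.trans_lt hT⟩
    have hnhds := Ioo_mem_nhds hs'.1 hs'.2
    have hd := hasDerivAt_of_potential_eq
      ((hcont.mono Ioo_subset_Ico_self).continuousAt hnhds)
      (eventually_of_mem hnhds hpot) (hreg s hs')
    have hne : 1 - Complex.exp (ζ s) ≠ 0 := sub_ne_zero.2 (hreg s hs').symm
    have h1 : HasDerivAt (fun s => ofLog c (ζ s))
        (2 / c * -(Complex.exp (ζ s) * (c ^ 2 / 2 / (1 - Complex.exp (ζ s))))) s :=
      (hd.cexp.const_sub 1).const_mul (2 / c)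
    refine (h1.congr_deriv ?_).hasDerivWithinAt
    rw [ofLog]
    field_simp
    ring

theorem neg_two_le_re_of_potential {ζ : ℂ} (h : 0 ≤ (potential ζ).re) : -2 ≤ ζ.re := by
  by_contra hlt
  push Not at hlt
  rw [potential_re] at h
  have h1 : Real.exp ζ.re ≤ 1 := Real.exp_le_one_iff.2 (by linarith)
  have h2 := Real.neg_one_le_cos ζ.im
  have h3 := Real.exp_pos ζ.re
  nlinarith

/-- The bounds on `ζ` give `‖a‖ s ≤ 3 + 2 π + 2 exp (Re ζ)`, so `exp (Re ζ) - 1`, and with it `‖1 -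
exp ζ‖`, grows at least linearly. -/
theorem tendsto_ofLog_cobounded {a c : ℂ} (ha : a ≠ 0) (hc : c ≠ 0) {ζ : ℝ → ℂ}
    (hpot : ∀ s > 0, potential (ζ s) = a * (s : ℂ)) (hre : ∀ s > 0, -2 ≤ (ζ s).re)
    (him : ∀ s > 0, |(ζ s).im| ≤ 2 * Real.pi) :
    Tendsto (fun s => ofLog c (ζ s)) atTop (Bornology.cobounded ℂ) := by
  rw [← tendsto_norm_atTop_iff_cobounded]
  have hlow : ∀ s > 0, ‖2 / c‖ * ((‖a‖ * s - (3 + 2 * Real.pi)) / 2 - 1) ≤ ‖ofLog c (ζ s)‖ := by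
    intro s hs
    rw [ofLog, norm_mul]
    gcongr
    have h1 : ‖a‖ * s = ‖potential (ζ s)‖ := by
      rw [hpot s hs, norm_mul, Complex.norm_real, Real.norm_of_nonneg hs.le]
    have h2 : ‖potential (ζ s)‖ ≤ 1 + ‖ζ s‖ + Real.exp (ζ s).re := by
      rw [← Complex.norm_exp]
      calc ‖potential (ζ s)‖ ≤ ‖1 + ζ s‖ + ‖Complex.exp (ζ s)‖ := norm_sub_le _ _
        _ ≤ ‖(1 : ℂ)‖ + ‖ζ s‖ + ‖Complex.exp (ζ s)‖ := by gcongr; exact norm_add_le _ _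
        _ = _ := by simp
    have h3 : ‖ζ s‖ ≤ |(ζ s).re| + |(ζ s).im| := Complex.norm_le_abs_re_add_abs_im _
    have h4 : |(ζ s).re| ≤ 2 + Real.exp (ζ s).re := by
      have := Real.add_one_le_exp (ζ s).re
      have := Real.exp_pos (ζ s).re
      exact abs_le.2 ⟨by linarith [hre s hs], by linarith⟩
    have h5 : Real.exp (ζ s).re - 1 ≤ ‖1 - Complex.exp (ζ s)‖ := by
      have := norm_sub_norm_le (Complex.exp (ζ s)) 1
      rw [Complex.norm_exp, norm_one, norm_sub_rev] at this
      exact this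
    linarith [him s hs]
  refine tendsto_atTop_mono' atTop ((eventually_gt_atTop 0).mono hlow) ?_
  have hcn : 0 < ‖2 / c‖ := norm_pos_iff.2 (div_ne_zero two_ne_zero hc)
  have han : 0 < ‖a‖ := norm_pos_iff.2 ha
  refine Tendsto.const_mul_atTop hcn (tendsto_atTop_add_const_right _ (-1)
    (Tendsto.atTop_div_const two_pos (tendsto_atTop_add_const_right _ (-(3 + 2 * Real.pi))
      (tendsto_id.const_mul_atTop han))))

/-! ### Construction of the trajectories in the two simple phases. -/

section phases

variable {c : ℂ}

theorem sq_half_re (c : ℂ) : (c ^ 2 / 2).re = (c.re ^ 2 - c.im ^ 2) / 2 := by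
  simp [sq]

theorem sq_half_im (c : ℂ) : (c ^ 2 / 2).im = c.re * c.im := by
  simp [sq]; ring

theorem mul_ofReal_re_im (a : ℂ) (s : ℝ) :
    (a * (s : ℂ)).re = a.re * s ∧ (a * (s : ℂ)).im = a.im * s := by simp

/-- The logarithmic coordinate needs `c ≠ 0`; here `y' = -2 / y` is solved directly by `± 2 i √s`.
-/
theorem exists_branchPair_zero : ∃ γp γm, IsBranchPair 0 γp γm ∧
    Tendsto γp atTop (Bornology.cobounded ℂ) ∧ Tendsto γm atTop (Bornology.cobounded ℂ) := by
  have traj : ∀ σ : ℂ, σ ^ 2 = 1 → ∀ T,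
      IsReverseTrajectory 0 T (fun s => σ * (2 * Complex.I) * (Real.sqrt s : ℂ)) := by
    intro σ hσ T
    have hσ0 : σ ≠ 0 := fun h => by simp [h] at hσ
    have hne : ∀ s > 0, σ * (2 * Complex.I) * (Real.sqrt s : ℂ) ≠ 0 := fun s hs => by
      have : (Real.sqrt s : ℂ) ≠ 0 := by exact_mod_cast (Real.sqrt_pos.2 hs).ne'
      simp [hσ0, this]
    refine ⟨by simp, ?_, fun s hs => hne s hs.1, fun s hs => ?_⟩
    · exact (continuous_const.mul
        (Complex.continuous_ofReal.comp Real.continuous_sqrt)).continuousOn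
    · have h1 := ((Real.hasDerivAt_sqrt hs.1.ne').ofReal_comp).const_mul (σ * (2 * Complex.I))
      refine (h1.congr_deriv ?_).hasDerivWithinAt
      have h2 : (Real.sqrt s : ℂ) ≠ 0 := by exact_mod_cast (Real.sqrt_pos.2 hs.1).ne'
      have hI := Complex.I_sq
      push_cast
      field_simp
      linear_combination σ ^ 2 * hI - hσ
  have lim : ∀ σ : ℂ, σ ^ 2 = 1 → Tendsto (fun s : ℝ => σ * (2 * Complex.I) * (Real.sqrt s : ℂ))
      atTop (Bornology.cobounded ℂ) := by
    intro σ hσ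
    have hσ0 : σ ≠ 0 := fun h => by simp [h] at hσ
    rw [← tendsto_norm_atTop_iff_cobounded]
    have : 0 < ‖σ * (2 * Complex.I)‖ := by simp [hσ0]
    refine (Real.tendsto_sqrt_atTop.const_mul_atTop this).congr fun s => ?_
    rw [norm_mul _ (Real.sqrt s : ℂ), Complex.norm_real, Real.norm_of_nonneg (Real.sqrt_nonneg s)]
  refine ⟨_, _, ⟨traj 1 (by norm_num), traj (-1) (by norm_num), fun s hs h => ?_⟩,
    lim 1 (by norm_num), lim (-1) (by norm_num)⟩
  have h2 : (Real.sqrt s : ℂ) ≠ 0 := by exact_mod_cast (Real.sqrt_pos.2 hs).ne'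
  have : (4 * Complex.I) * (Real.sqrt s : ℂ) = 0 := by linear_combination h
  simp [h2] at this

theorem exists_branchPair_of_pos (h : 0 < c.re ^ 2 - c.im ^ 2) : ∃ γp γm, IsBranchPair c γp γm ∧
    Tendsto γp atTop (Bornology.cobounded ℂ) ∧ Tendsto γm atTop (Bornology.cobounded ℂ) := by
  have hc : c ≠ 0 := fun h0 => by simp [h0] at h
  set a : ℂ := c ^ 2 / 2 with ha
  have hare : 0 < a.re := by rw [ha, sq_half_re]; linarith
  have ha0 : a ≠ 0 := fun h0 => by simp [h0] at hare
  obtain ⟨G, hGc, hG⟩ := exists_upper_inverse_potential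
  have up : ∀ b : ℂ, 0 < b.re → (∀ S, ContinuousOn (rayLift G b) (Ico 0 S)) ∧
      ∀ s > 0, potential (rayLift G b s) = b * (s : ℂ) ∧ 0 < (rayLift G b s).im ∧
        (rayLift G b s).im < 2 * Real.pi ∧ -2 ≤ (rayLift G b s).re ∧
        Complex.exp (rayLift G b s) ≠ 1 := by
    intro b hb
    have hray : ∀ s : ℝ, 0 < s → b * (s : ℂ) ∈ {w : ℂ | 0 < w.re} := fun s hs => by
      have := mul_pos hb hs
      simpa using this
    refine ⟨fun S => continuousOn_rayLift hGc hG
      (fun ζ hζ => Or.inr (by rw [abs_of_pos hζ.1]; exact hζ.2.le))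
      (fun s hs => hray s hs.1), fun s hs => ?_⟩
    obtain ⟨⟨h1, h2⟩, h3⟩ := hG _ (hray s hs)
    have h4 : potential (rayLift G b s) = b * (s : ℂ) := by rw [rayLift_of_pos G b hs, h3]
    rw [← rayLift_of_pos G b hs] at h1 h2
    refine ⟨h4, h1, h2, neg_two_le_re_of_potential ?_, fun he => ?_⟩
    · rw [h4]; exact le_of_lt (hray s hs)
    · have hb0 : 0 < (b * (s : ℂ)).re := hray s hs
      have hre := congrArg norm he
      rw [Complex.norm_exp, norm_one] at hre
      have h5 : (rayLift G b s).re = 0 := by rwa [Real.exp_eq_one_iff] at hre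
      have h6 : (Complex.exp (rayLift G b s)).re = 1 := by rw [he]; simp
      rw [Complex.exp_re] at h6
      rw [← h4, potential_re, h6, h5] at hb0
      simp at hb0
  obtain ⟨cont₁, prop₁⟩ := up a hare
  obtain ⟨cont₂, prop₂⟩ := up (starRingEnd ℂ a) (by simpa using hare)
  -- The second lift is the conjugate of the upper lift of the conjugate ray, and so lies below the
  -- real axis.
  set ζ₁ := rayLift G a
  set ζ₂ : ℝ → ℂ := fun s => starRingEnd ℂ (rayLift G (starRingEnd ℂ a) s) with hζ₂
  have pot₂ : ∀ s > 0, potential (ζ₂ s) = a * (s : ℂ) := fun s hs => by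
    rw [hζ₂, potential_conj, (prop₂ s hs).1]; simp
  have im₂ : ∀ s > 0, (ζ₂ s).im < 0 := fun s hs => by
    have := (prop₂ s hs).2.1
    simpa [hζ₂] using this
  refine ⟨fun s => ofLog c (ζ₁ s), fun s => ofLog c (ζ₂ s), ⟨fun T => ?_, fun T => ?_,
    fun s hs h => ?_⟩, ?_, ?_⟩
  · exact isReverseTrajectory_ofLog hc (rayLift_zero _ _) (cont₁ (T + 1))
      (fun s hs => (prop₁ s hs.1).1) (fun s hs => (prop₁ s hs.1).2.2.2.2) (lt_add_one T)
  · refine isReverseTrajectory_ofLog hc (by simp [hζ₂, rayLift_zero])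
      (Complex.continuous_conj.comp_continuousOn (cont₂ (T + 1)))
      (fun s hs => pot₂ s hs.1) (fun s hs he => (prop₂ s hs.1).2.2.2.2 ?_) (lt_add_one T)
    have := congrArg (starRingEnd ℂ) he
    simpa [hζ₂, ← Complex.exp_conj] using this
  -- Equal points differ by `2 π i n` in the logarithm, and hence also in the potential. Both
  -- potentials are `a s`, so `n = 0`, against the signs of the imaginary parts.
  · obtain ⟨n, hn⟩ := Complex.exp_eq_exp_iff_exists_int.1 (exp_eq_exp_of_ofLog_eq hc h)
    have h1 := (prop₁ s hs).1
    rw [hn, potential_add_int, pot₂ s hs, add_eq_left] at h1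
    rw [h1, add_zero] at hn
    have h2 := im₂ s hs
    rw [← hn] at h2
    exact absurd (prop₁ s hs).2.1 (not_lt.2 h2.le)
  · exact tendsto_ofLog_cobounded ha0 hc (fun s hs => (prop₁ s hs).1)
      (fun s hs => (prop₁ s hs).2.2.2.1)
      (fun s hs => by rw [abs_of_pos (prop₁ s hs).2.1]; exact (prop₁ s hs).2.2.1.le)
  · refine tendsto_ofLog_cobounded ha0 hc pot₂ (fun s hs => ?_) (fun s hs => ?_)
    · simpa [hζ₂] using (prop₂ s hs).2.2.2.1
    · have := (prop₂ s hs).2.2.1.le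
      rw [← abs_of_pos (prop₂ s hs).2.1] at this
      simpa [hζ₂] using this

/-- The branch in the right half-strip, for rays in the closed left half-plane. -/
theorem exists_right_lift {a : ℂ} (ha : a.re ≤ 0) (ha0 : a ≠ 0) : ∃ ζ : ℝ → ℂ, ζ 0 = 0 ∧
    (∀ S, ContinuousOn ζ (Ico 0 S)) ∧
    ∀ s > 0, potential (ζ s) = a * (s : ℂ) ∧ 0 < (ζ s).re ∧ |(ζ s).im| < Real.pi := by
  obtain ⟨G, hGc, hG⟩ := exists_right_inverse_potential
  have hpi := Real.pi_pos
  have hray : ∀ s : ℝ, 0 < s → a * (s : ℂ) ∈ {w : ℂ | w.re ≤ 0 ∧ w ≠ 0} := fun s hs => by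
    refine ⟨?_, mul_ne_zero ha0 (by exact_mod_cast hs.ne')⟩
    rw [(mul_ofReal_re_im a s).1]
    exact mul_nonpos_of_nonpos_of_nonneg ha hs.le
  refine ⟨rayLift G a, rayLift_zero _ _, fun S => continuousOn_rayLift hGc hG
      (fun ζ hζ => Or.inr (by linarith [hζ.2])) (fun s hs => hray s hs.1), fun s hs => ?_⟩
  rw [rayLift_of_pos G a hs]
  exact ⟨(hG _ (hray s hs)).2, (hG _ (hray s hs)).1⟩

/-- The branch in the left half-plane, as long as the ray meets no critical value. -/
theorem exists_left_lift {a : ℂ} {S : ℝ} (ha : a.re ≤ 0)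
    (hcrit : ∀ s ∈ Ioo 0 S, ∀ n : ℤ, a * (s : ℂ) ≠ n * (2 * Real.pi * Complex.I)) :
    ∃ ζ : ℝ → ℂ, ζ 0 = 0 ∧ ContinuousOn ζ (Ico 0 S) ∧
    ∀ s ∈ Ioo 0 S, potential (ζ s) = a * (s : ℂ) ∧ (ζ s).re < 0 := by
  obtain ⟨G, hGc, hG⟩ := exists_left_inverse_potential
  have hray : ∀ s ∈ Ioo 0 S, a * (s : ℂ) ∈
      {w : ℂ | w.re ≤ 0 ∧ ∀ n : ℤ, w ≠ n * (2 * Real.pi * Complex.I)} := fun s hs => by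
    refine ⟨?_, hcrit s hs⟩
    rw [(mul_ofReal_re_im a s).1]
    exact mul_nonpos_of_nonpos_of_nonneg ha hs.1.le
  refine ⟨rayLift G a, rayLift_zero _ _, continuousOn_rayLift hGc hG
      (fun ζ hζ => Or.inl (le_of_lt hζ)) hray, fun s hs => ?_⟩
  rw [rayLift_of_pos G a hs.1]
  exact ⟨(hG _ (hray s hs)).2, (hG _ (hray s hs)).1⟩

theorem ofLog_ne_of_re {c : ℂ} (hc : c ≠ 0) {ζ ξ : ℂ} (hζ : 0 < ζ.re) (hξ : ξ.re < 0) :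
    ofLog c ζ ≠ ofLog c ξ := fun h => by
  have := congrArg norm (exp_eq_exp_of_ofLog_eq hc h)
  rw [Complex.norm_exp, Complex.norm_exp, Real.exp_eq_exp] at this
  linarith

/-- Up to a constant the argument is `Im ζ`, which differs from `Im a * s` by `exp (Re ζ) * sin (Im
ζ)`, at most `1` in absolute value. -/
theorem windsInfinitely_ofLog {c a : ℂ} (ha : a.im ≠ 0) {ζ : ℝ → ℂ}
    (hcont : ContinuousOn ζ (Ici 0))
    (hpot : ∀ s > 0, potential (ζ s) = a * (s : ℂ)) (hre : ∀ s > 0, (ζ s).re < 0) :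
    WindsInfinitely (fun t => ofLog c (ζ t)) (2 / c) := by
  refine ⟨fun t => Complex.arg (-(2 / c)) + (ζ t).im, ?_, fun t _ => ?_, ?_⟩
  · exact continuousOn_const.add (Complex.continuous_im.comp_continuousOn hcont)
  · rw [ofLog_sub, norm_mul, Complex.norm_exp]
    conv_lhs => rw [← Complex.norm_mul_exp_arg_mul_I (-(2 / c)), ← Complex.re_add_im (ζ t)]
    push_cast
    rw [Complex.exp_add, add_mul, Complex.exp_add]
    ring
  · have hb : ∀ s > 0, a.im * s - 1 ≤ (ζ s).im ∧ (ζ s).im ≤ a.im * s + 1 := by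
      intro s hs
      have h1 := potential_im (ζ s)
      rw [hpot s hs, (mul_ofReal_re_im a s).2] at h1
      have h2 : Real.exp (ζ s).re ≤ 1 := Real.exp_le_one_iff.2 (hre s hs).le
      have h3 := Real.exp_pos (ζ s).re
      have h4 : |Real.exp (ζ s).re * Real.sin (ζ s).im| ≤ 1 := by
        rw [abs_mul, abs_of_pos h3]
        exact mul_le_one₀ h2 (abs_nonneg _) (Real.abs_sin_le_one _)
      have h5 := abs_le.1 h4
      constructor <;> linarith
    rcases lt_or_gt_of_ne ha with hneg | hpos
    · right
      refine tendsto_atBot_add_const_left _ _ (tendsto_atBot_mono' atTop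
        ((eventually_gt_atTop 0).mono fun s hs => (hb s hs).2)
        (tendsto_atBot_add_const_right _ 1 ?_))
      exact tendsto_id.const_mul_atTop_of_neg hneg
    · left
      refine tendsto_atTop_add_const_left _ _ (tendsto_atTop_mono' atTop
        ((eventually_gt_atTop 0).mono fun s hs => (hb s hs).1)
        (tendsto_atTop_add_const_right _ (-1) ?_))
      exact tendsto_id.const_mul_atTop hpos

theorem exists_branchPair_of_neg (h : c.re ^ 2 - c.im ^ 2 < 0) : ∃ γp γm, IsBranchPair c γp γm ∧
    Tendsto γp atTop (Bornology.cobounded ℂ) ∧ Tendsto γm atTop (𝓝 (2 / c)) ∧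
    (∀ s, γp s ≠ 2 / c ∧ γm s ≠ 2 / c) ∧ (c.re ≠ 0 → WindsInfinitely γm (2 / c)) ∧
    (c.re = 0 → ∀ t, 0 ≤ t → γm t ∈ segment ℝ 0 (2 / c)) := by
  have hc : c ≠ 0 := fun h0 => by simp [h0] at h
  set a : ℂ := c ^ 2 / 2 with ha
  have hare : a.re < 0 := by rw [ha, sq_half_re]; linarith
  have ha0 : a ≠ 0 := fun h0 => by simp [h0] at hare
  have hreal : ∀ s : ℝ, 0 < s → (a * (s : ℂ)).re < 0 := fun s hs => by
    rw [(mul_ofReal_re_im a s).1]; exact mul_neg_of_neg_of_pos hare hs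
  obtain ⟨ζ₁, z₁, cont₁, prop₁⟩ := exists_right_lift hare.le ha0
  obtain ⟨G, hGc, hG⟩ := exists_left_inverse_potential
  have hray : ∀ s : ℝ, 0 < s → a * (s : ℂ) ∈
      {w : ℂ | w.re ≤ 0 ∧ ∀ n : ℤ, w ≠ n * (2 * Real.pi * Complex.I)} := fun s hs => by
    have := hreal s hs
    refine ⟨this.le, fun n hn => ?_⟩
    rw [hn] at this
    simp at this
  set ζ₂ := rayLift G a with hζ₂
  have cont₂ : ∀ S, ContinuousOn ζ₂ (Ico 0 S) := fun S => continuousOn_rayLift hGc hG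
      (fun ζ hζ => Or.inl (le_of_lt hζ)) fun s hs => hray s hs.1
  have prop₂ : ∀ s > 0, potential (ζ₂ s) = a * (s : ℂ) ∧ (ζ₂ s).re < 0 := fun s hs => by
    rw [hζ₂, rayLift_of_pos G a hs]
    exact ⟨(hG _ (hray s hs)).2, (hG _ (hray s hs)).1⟩
  have cont₂' : ContinuousOn ζ₂ (Ici 0) := continuousOn_Ici_of_forall_Icc fun T =>
    (cont₂ (T + 1)).mono fun s hs => ⟨hs.1, by linarith [hs.2]⟩
  refine ⟨fun s => ofLog c (ζ₁ s), fun s => ofLog c (ζ₂ s), ⟨fun T => ?_, fun T => ?_,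
    fun s hs => ofLog_ne_of_re hc (prop₁ s hs).2.1 (prop₂ s hs).2⟩, ?_, ?_,
    fun s => ⟨ofLog_ne hc _, ofLog_ne hc _⟩, fun hcre => ?_, fun hcre t ht => ?_⟩
  · exact isReverseTrajectory_ofLog hc z₁ (cont₁ (T + 1)) (fun s hs => (prop₁ s hs.1).1)
      (fun s hs => exp_ne_one_of_re_ne_zero (prop₁ s hs.1).2.1.ne') (lt_add_one T)
  · exact isReverseTrajectory_ofLog hc (rayLift_zero _ _) (cont₂ (T + 1))
      (fun s hs => (prop₂ s hs.1).1)
      (fun s hs => exp_ne_one_of_re_ne_zero (prop₂ s hs.1).2.ne) (lt_add_one T)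
  · have hpi := Real.pi_pos
    exact tendsto_ofLog_cobounded ha0 hc (fun s hs => (prop₁ s hs).1)
      (fun s hs => by linarith [(prop₁ s hs).2.1]) (fun s hs => by linarith [(prop₁ s hs).2.2])
  -- Since `exp (Re ζ) * cos (Im ζ) ≤ 1`, the real part of the potential equation gives `Re ζ ≤ a.re
  -- * s`.
  · have hlim : Tendsto (fun s => (ζ₂ s).re) atTop atBot := by
      refine tendsto_atBot_mono' atTop ((eventually_gt_atTop 0).mono fun s hs => ?_)
        (tendsto_id.const_mul_atTop_of_neg hare)
      have h1 := potential_re (ζ₂ s)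
      rw [(prop₂ s hs).1, (mul_ofReal_re_im a s).1] at h1
      have h2 : Real.exp (ζ₂ s).re ≤ 1 := Real.exp_le_one_iff.2 (prop₂ s hs).2.le
      have h3 := Real.exp_pos (ζ₂ s).re
      have h4 := Real.cos_le_one (ζ₂ s).im
      change (ζ₂ s).re ≤ a.re * s
      nlinarith
    have hexp : Tendsto (fun s => Complex.exp (ζ₂ s)) atTop (𝓝 0) := by
      rw [tendsto_zero_iff_norm_tendsto_zero]
      simp only [Complex.norm_exp]
      exact Real.tendsto_exp_atBot.comp hlim
    have := (hexp.const_sub 1).const_mul (2 / c)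
    simpa [ofLog] using this
  · refine windsInfinitely_ofLog ?_ cont₂' (fun s hs => (prop₂ s hs).1)
      (fun s hs => (prop₂ s hs).2)
    rw [ha, sq_half_im]
    refine mul_ne_zero hcre fun h0 => ?_
    rw [h0] at h
    nlinarith
  · rcases ht.eq_or_lt with rfl | hpos
    · simpa [hζ₂, rayLift_zero, ofLog] using left_mem_segment ℝ 0 (2 / c)
    have him : a.im = 0 := by rw [ha, sq_half_im, hcre, zero_mul]
    -- For real `a` the conjugate is a second preimage in the left half-plane, so injectivity makes
    -- `ζ₂ t` real.
    have hconj : starRingEnd ℂ (ζ₂ t) = ζ₂ t := by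
      refine injOn_potential_re_neg ?_ (prop₂ t hpos).2 ?_
      · simpa using (prop₂ t hpos).2
      · rw [potential_conj, (prop₂ t hpos).1, map_mul, Complex.conj_ofReal,
          Complex.conj_eq_iff_im.2 him]
    have hr : ζ₂ t = ((ζ₂ t).re : ℂ) := (Complex.conj_eq_iff_re.1 hconj).symm
    have h1 : Real.exp (ζ₂ t).re ≤ 1 := Real.exp_le_one_iff.2 (prop₂ t hpos).2.le
    have h2 := Real.exp_pos (ζ₂ t).re
    refine ⟨Real.exp (ζ₂ t).re, 1 - Real.exp (ζ₂ t).re, h2.le, by linarith, by ring, ?_⟩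
    change _ = ofLog c (ζ₂ t)
    rw [ofLog, hr]
    simp only [smul_zero, zero_add, Complex.real_smul, Complex.ofReal_re]
    push_cast
    ring

end phases

/-! ### The loop of the exotic phase and its interior. -/

/-- The loop of the exotic phase in the coordinate `q = 1 - c z / 2`. -/
def loopSet : Set ℂ := {q | ‖q‖ ≤ 1 ∧ ‖q‖ = Real.exp (q.re - 1)}

/-- The region inside `loopSet`. -/
def loopInside : Set ℂ := {q | ‖q‖ < 1 ∧ ‖q‖ < Real.exp (q.re - 1)}

/-- The region outside `loopSet`. -/
def loopOutside : Set ℂ := {q | 1 < ‖q‖ ∨ Real.exp (q.re - 1) < ‖q‖}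

theorem continuous_exp_re : Continuous fun q : ℂ => Real.exp (q.re - 1) :=
  Real.continuous_exp.comp (Complex.continuous_re.sub continuous_const)

theorem isOpen_loopInside : IsOpen loopInside :=
  (isOpen_lt continuous_norm continuous_const).inter
    (isOpen_lt continuous_norm continuous_exp_re)

theorem isOpen_loopOutside : IsOpen loopOutside :=
  (isOpen_lt continuous_const continuous_norm).union
    (isOpen_lt continuous_exp_re continuous_norm)

theorem zero_mem_loopInside : (0 : ℂ) ∈ loopInside := by
  simp [loopInside, Real.exp_pos]

theorem disjoint_loopInside_loopOutside : Disjoint loopInside loopOutside := by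
  rw [Set.disjoint_left]
  rintro q ⟨h1, h2⟩ (h3 | h3) <;> linarith

theorem compl_loopSet : loopSetᶜ = loopInside ∪ loopOutside := by
  ext q
  constructor
  · intro hq
    rcases lt_or_ge 1 ‖q‖ with h | h
    · exact Or.inr (Or.inl h)
    rcases lt_trichotomy ‖q‖ (Real.exp (q.re - 1)) with h' | h' | h'
    -- On the unit circle `Re q ≤ 1` makes the exponential at most `1`, so the second inequality
    -- already excludes `‖q‖ = 1`.
    · refine Or.inl ⟨lt_of_le_of_ne h fun h1 => ?_, h'⟩
      have h2 : Real.exp (q.re - 1) ≤ 1 :=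
        Real.exp_le_one_iff.2 (by linarith [Complex.re_le_norm q])
      linarith
    · exact absurd ⟨h, h'⟩ hq
    · exact Or.inr (Or.inr h')
  · rintro (⟨h1, h2⟩ | h | h) ⟨h3, h4⟩ <;> linarith

/-- It combines `t ≤ exp (t - 1)` with `(1 - t) (1 - x) ≥ 0`. It makes `loopInside` star-shaped
about `0` and `loopOutside` stable under dilations. -/
theorem mul_exp_le_exp_mul {t x : ℝ} (ht1 : t ≤ 1) (hx : x ≤ 1) :
    t * Real.exp (x - 1) ≤ Real.exp (t * x - 1) := by
  have h1 : t ≤ Real.exp (t - 1) := by linarith [Real.add_one_le_exp (t - 1)]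
  calc t * Real.exp (x - 1) ≤ Real.exp (t - 1) * Real.exp (x - 1) := by gcongr
    _ = Real.exp (t - 1 + (x - 1)) := (Real.exp_add _ _).symm
    _ ≤ _ := Real.exp_le_exp.2 (by nlinarith)

theorem smul_mem_loopInside {q : ℂ} (hq : q ∈ loopInside) {t : ℝ} (h0 : 0 ≤ t) (h1 : t ≤ 1) :
    t • q ∈ loopInside := by
  rcases h0.eq_or_lt with rfl | hpos
  · simpa using zero_mem_loopInside
  have hre : q.re ≤ 1 := (Complex.re_le_norm q).trans hq.1.le
  have hnorm : ‖t • q‖ = t * ‖q‖ := by rw [norm_smul, Real.norm_of_nonneg h0]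
  refine ⟨?_, ?_⟩
  · rw [hnorm]
    nlinarith [norm_nonneg q, hq.1]
  · rw [hnorm, Complex.smul_re, smul_eq_mul]
    exact (mul_lt_mul_of_pos_left hq.2 hpos).trans_le (mul_exp_le_exp_mul h1 hre)

theorem smul_mem_loopOutside {q : ℂ} (hq : q ∈ loopOutside) {t : ℝ} (h1 : 1 ≤ t) :
    t • q ∈ loopOutside := by
  have ht : 0 < t := by linarith
  have hnorm : ‖t • q‖ = t * ‖q‖ := by rw [norm_smul, Real.norm_of_nonneg ht.le]
  rcases hq with hq | hq
  · left
    rw [hnorm]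
    nlinarith
  · by_cases hbig : 1 < ‖t • q‖
    · exact Or.inl hbig
    right
    have hre : (t • q).re ≤ 1 := (Complex.re_le_norm _).trans (not_lt.1 hbig)
    have h2 := mul_exp_le_exp_mul (t := t⁻¹) (x := (t • q).re) (inv_le_one_of_one_le₀ h1) hre
    have h3 : t⁻¹ * (t • q).re = q.re := by
      rw [Complex.smul_re, smul_eq_mul, inv_mul_cancel_left₀ ht.ne']
    rw [h3] at h2
    have h4 := h2.trans_lt hq
    rw [hnorm]
    rwa [inv_mul_lt_iff₀ ht] at h4

/-- A criterion that identifies the interior of a set which separates the plane. -/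
theorem interiorOf_eq {J U E : Set ℂ} (hU : IsOpen U) (hE : IsOpen E) (hUE : Disjoint U E)
    (hJ : Jᶜ = U ∪ E) (hbdd : Bornology.IsBounded U)
    (hunb : ∀ z ∈ E, ∃ A ⊆ E, z ∈ A ∧ IsPreconnected A ∧ ¬ Bornology.IsBounded A) :
    interiorOf J = U := by
  ext z
  constructor
  · rintro ⟨hz, hb⟩
    have hz' : z ∈ U ∪ E := hJ ▸ hz
    refine hz'.resolve_right fun hzE => ?_
    obtain ⟨A, hAE, hzA, hA, hAb⟩ := hunb z hzE
    refine hAb (hb.subset (hA.subset_connectedComponentIn hzA ?_))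
    rw [hJ]
    exact hAE.trans subset_union_right
  · intro hz
    have hzJ : z ∈ Jᶜ := by rw [hJ]; exact Or.inl hz
    refine ⟨hzJ, hbdd.subset ?_⟩
    refine IsPreconnected.subset_left_of_subset_union hU hE hUE ?_
      ⟨z, mem_connectedComponentIn hzJ, hz⟩ isPreconnected_connectedComponentIn
    rw [← hJ]
    exact connectedComponentIn_subset _ _

/-- The coordinate change `z ↦ 1 - c z / 2`. -/
noncomputable def qCoord (c z : ℂ) : ℂ := 1 - c * z / 2

theorem continuous_qCoord (c : ℂ) : Continuous (qCoord c) := by unfold qCoord; fun_prop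

theorem qCoord_symm {c : ℂ} (hc : c ≠ 0) (q : ℂ) : qCoord c (2 / c * (1 - q)) = q := by
  rw [qCoord]; field_simp; ring

theorem symm_qCoord {c : ℂ} (hc : c ≠ 0) (z : ℂ) : 2 / c * (1 - qCoord c z) = z := by
  rw [qCoord]; field_simp; ring

theorem isBounded_preimage_loopInside {c : ℂ} (hc : c ≠ 0) :
    Bornology.IsBounded (qCoord c ⁻¹' loopInside) := by
  refine (Metric.isBounded_closedBall (x := (0 : ℂ)) (r := ‖2 / c‖ * 2)).subset fun z hz => ?_
  rw [mem_closedBall_zero_iff, ← symm_qCoord hc z, norm_mul]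
  gcongr
  have := norm_sub_le 1 (qCoord c z)
  rw [norm_one] at this
  linarith [hz.1]

theorem isConnected_preimage_loopInside {c : ℂ} (hc : c ≠ 0) :
    IsConnected (qCoord c ⁻¹' loopInside) := by
  have hstar : StarConvex ℝ 0 loopInside := starConvex_zero_iff.2
    fun q hq t h0 h1 => smul_mem_loopInside hq h0 h1
  have himg : qCoord c ⁻¹' loopInside = (fun q => 2 / c * (1 - q)) '' loopInside := by
    ext z
    constructor
    · exact fun hz => ⟨qCoord c z, hz, symm_qCoord hc z⟩
    · rintro ⟨q, hq, rfl⟩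
      rw [mem_preimage, qCoord_symm hc]
      exact hq
  rw [himg]
  exact ((hstar.isPathConnected zero_mem_loopInside).isConnected).image _ (by fun_prop)

theorem interiorOf_preimage_loopSet {c : ℂ} (hc : c ≠ 0) :
    interiorOf (qCoord c ⁻¹' loopSet) = qCoord c ⁻¹' loopInside := by
  refine interiorOf_eq (isOpen_loopInside.preimage (continuous_qCoord c))
    (isOpen_loopOutside.preimage (continuous_qCoord c))
    (disjoint_loopInside_loopOutside.preimage _) ?_ (isBounded_preimage_loopInside hc) ?_
  · rw [← preimage_compl, compl_loopSet, preimage_union]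
  · intro z hz
    have hq0 : qCoord c z ≠ 0 := fun h0 => by
      have : qCoord c z ∈ loopOutside := hz
      rw [h0] at this
      exact Set.disjoint_left.1 disjoint_loopInside_loopOutside zero_mem_loopInside this
    have hcn : 0 < ‖2 / c‖ := norm_pos_iff.2 (div_ne_zero two_ne_zero hc)
    have hqn : 0 < ‖qCoord c z‖ := norm_pos_iff.2 hq0
    -- The radial ray outwards from `qCoord c z` stays outside the loop and is unbounded.
    refine ⟨(fun t : ℝ => 2 / c * (1 - t • qCoord c z)) '' Ici 1, ?_, ?_, ?_, ?_⟩
    · rintro _ ⟨t, ht, rfl⟩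
      rw [mem_preimage, qCoord_symm hc]
      exact smul_mem_loopOutside hz ht
    · exact ⟨1, mem_Ici.2 le_rfl, by simp only [one_smul]; exact symm_qCoord hc z⟩
    · exact isPreconnected_Ici.image _ (by fun_prop)
    · intro hb
      obtain ⟨R, hR⟩ := hb.exists_norm_le
      set t := max 1 ((R / ‖2 / c‖ + 2) / ‖qCoord c z‖) with ht
      have h1 := hR _ ⟨t, mem_Ici.2 (le_max_left _ _), rfl⟩
      have ht0 : 0 ≤ t := zero_le_one.trans (le_max_left _ _)
      have h2 : (R / ‖2 / c‖ + 2) ≤ t * ‖qCoord c z‖ := by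
        rw [← div_le_iff₀ hqn]
        exact le_max_right _ _
      have h3 : t * ‖qCoord c z‖ - 1 ≤ ‖1 - t • qCoord c z‖ := by
        have := norm_sub_norm_le (t • qCoord c z) 1
        rw [norm_one, norm_sub_rev, norm_smul, Real.norm_of_nonneg ht0] at this
        exact this
      have h4 : R / ‖2 / c‖ < ‖1 - t • qCoord c z‖ := by linarith
      rw [div_lt_iff₀ hcn] at h4
      rw [norm_mul] at h1
      linarith

/-- The hypothesis says `Re ζ = Re (exp ζ) - 1`: the loop equation is the preimage of the imaginary
axis under the potential. -/
theorem norm_exp_eq_of_potential_re {ζ : ℂ} (h : (potential ζ).re = 0) :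
    ‖Complex.exp ζ‖ = Real.exp ((Complex.exp ζ).re - 1) := by
  rw [Complex.norm_exp]
  congr 1
  rw [potential_re, ← Complex.exp_re] at h
  linarith

/-- Every point of `loopSet` other than `1` is hit by a lift of the open segment between two
consecutive critical values. -/
theorem exists_log_of_mem_loopSet {q : ℂ} (hq : q ∈ loopSet) (hq1 : q ≠ 1) :
    ∃ ζ : ℂ, Complex.exp ζ = q ∧ ζ.re < 0 ∧ (potential ζ).re = 0 ∧ 0 < (potential ζ).im ∧
      (potential ζ).im < 2 * Real.pi := by
  have hpi := Real.pi_pos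
  obtain ⟨hle, heq⟩ := hq
  have hq0 : q ≠ 0 := fun h0 => by
    rw [h0, norm_zero] at heq
    exact (Real.exp_pos _).ne heq
  have hlt : ‖q‖ < 1 := by
    refine lt_of_le_of_ne hle fun h1 => hq1 ?_
    have hre : q.re = 1 := by
      rw [h1] at heq
      have := Real.exp_eq_one_iff _ |>.1 heq.symm
      linarith
    have hsq := Complex.sq_norm q
    rw [h1, Complex.normSq_apply, hre] at hsq
    have : q.im = 0 := by nlinarith
    exact Complex.ext hre this
  have hexp : Complex.exp (Complex.log q) = q := Complex.exp_log hq0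
  have hre : (Complex.log q).re < 0 := by
    rw [Complex.log_re]
    exact Real.log_neg (norm_pos_iff.2 hq0) hlt
  have hpre : (potential (Complex.log q)).re = 0 := by
    rw [potential_re, ← Complex.exp_re, hexp, Complex.log_re, heq, Real.log_exp]
    ring
  set v := (potential (Complex.log q)).im with hv
  -- Shifting by periods replaces the imaginary part of the potential by its remainder modulo `2 π`.
  -- The remainder is not `0`, since the only zero of the potential in `properDomain` is `0` and
  -- here `Re ζ < 0`.
  set n : ℤ := -⌊v / (2 * Real.pi)⌋ with hn
  have him : (potential (Complex.log q + n * (2 * Real.pi * Complex.I))).im =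
      2 * Real.pi * Int.fract (v / (2 * Real.pi)) := by
    have hfract := Int.self_sub_floor (v / (2 * Real.pi))
    have hdiv : v = 2 * Real.pi * (v / (2 * Real.pi)) := by field_simp
    rw [potential_add_int, Complex.add_im, ← hv, ← hfract, mul_sub, ← hdiv, hn]
    simp
    ring
  have hre' : (Complex.log q + n * (2 * Real.pi * Complex.I)).re = (Complex.log q).re := by simp
  have hpre' : (potential (Complex.log q + n * (2 * Real.pi * Complex.I))).re = 0 := by
    rw [potential_add_int]; simpa using hpre
  refine ⟨Complex.log q + n * (2 * Real.pi * Complex.I), ?_, by rwa [hre'], hpre', ?_, ?_⟩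
  · rw [← hexp]
    exact Complex.exp_eq_exp_iff_exists_int.2 ⟨n, by rw [hexp]⟩
  · rw [him]
    refine mul_pos (by positivity) (lt_of_le_of_ne (Int.fract_nonneg _) fun h0 => ?_)
    rw [← h0, mul_zero] at him
    have h1 := eq_zero_of_potential_eq_zero (Or.inl (by rw [hre']; exact hre.le))
      (Complex.ext hpre' him)
    rw [h1] at hre'
    simp only [Complex.zero_re] at hre'
    linarith
  · rw [him]
    have := Int.fract_lt_one (v / (2 * Real.pi))
    nlinarith

/-! ### The exotic curve. -/

theorem exists_loopPair {c : ℂ} (h : c.re ^ 2 - c.im ^ 2 = 0) (hc : c ≠ 0) :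
    ∃ γp γm, IsLoopPair c γp γm (4 * Real.pi / ‖c‖ ^ 2) ∧
      Tendsto γp atTop (Bornology.cobounded ℂ) ∧
      (∀ s, 0 ≤ s → qCoord c (γp s) ∉ loopInside) ∧
      γm '' Icc 0 (4 * Real.pi / ‖c‖ ^ 2) = qCoord c ⁻¹' loopSet := by
  have hpi := Real.pi_pos
  have hcn : 0 < ‖c‖ := norm_pos_iff.2 hc
  set S := 4 * Real.pi / ‖c‖ ^ 2 with hS
  have hSpos : 0 < S := by positivity
  set a : ℂ := c ^ 2 / 2 with ha
  have ha0 : a ≠ 0 := by rw [ha]; simp [hc]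
  have hare : a.re = 0 := by rw [ha, sq_half_re, h, zero_div]
  have hanorm : ‖a‖ = ‖c‖ ^ 2 / 2 := by rw [ha]; simp
  have haS : ‖a‖ * S = 2 * Real.pi := by rw [hanorm, hS]; field_simp; ring
  have haim : |a.im| = ‖a‖ := (Complex.abs_im_eq_norm.2 hare)
  have hasre : ∀ s : ℝ, (a * (s : ℂ)).re = 0 := fun s => by
    rw [(mul_ofReal_re_im a s).1, hare, zero_mul]
  -- The sign `σ` records which of the critical values `± 2 π i` the ray runs into; it gets there
  -- exactly at time `S`.
  obtain ⟨σ, hσ, hσa⟩ : ∃ σ : ℤ, (σ = 1 ∨ σ = -1) ∧ a.im = σ * ‖a‖ := by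
    rcases abs_choice a.im with h' | h'
    · exact ⟨1, Or.inl rfl, by rw [← haim, h']; simp⟩
    · exact ⟨-1, Or.inr rfl, by rw [← haim, h']; simp⟩
  have hcrit : ∀ s ∈ Ioo 0 S, ∀ n : ℤ, a * (s : ℂ) ≠ n * (2 * Real.pi * Complex.I) := by
    intro s hs n hn
    have hnorm := congrArg norm hn
    rw [norm_mul, norm_mul, Complex.norm_real, Real.norm_of_nonneg hs.1.le] at hnorm
    have h2 : ‖(2 * Real.pi * Complex.I : ℂ)‖ = 2 * Real.pi := by
      simp [abs_of_pos hpi]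
    rw [h2, Complex.norm_intCast] at hnorm
    have hapos : 0 < ‖a‖ := norm_pos_iff.2 ha0
    have h3 : 0 < ‖a‖ * s := mul_pos hapos hs.1
    have h4 : ‖a‖ * s < 2 * Real.pi := by
      rw [← haS]; exact mul_lt_mul_of_pos_left hs.2 hapos
    rw [hnorm] at h3 h4
    have h5 : 0 < |(n : ℝ)| := by
      by_contra hcon
      have := mul_nonpos_of_nonpos_of_nonneg (not_lt.1 hcon) (by positivity : 0 ≤ 2 * Real.pi)
      linarith
    have h6 : |(n : ℝ)| < 1 := by
      by_contra hcon
      have := mul_le_mul_of_nonneg_right (not_lt.1 hcon) (by positivity : 0 ≤ 2 * Real.pi)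
      linarith
    have h7 : (0 : ℤ) < |n| := by exact_mod_cast h5
    have h8 : |n| < (1 : ℤ) := by exact_mod_cast h6
    omega
  obtain ⟨ζ₁, z₁, cont₁, prop₁⟩ := exists_right_lift hare.le ha0
  obtain ⟨ζ₂, z₂, cont₂, prop₂⟩ := exists_left_lift (a := a) (S := S) hare.le hcrit
  set p : ℂ := σ * (2 * Real.pi * Complex.I) with hp
  have hexpp : Complex.exp p = 1 := Complex.exp_eq_one_iff.2 ⟨σ, rfl⟩
  have hpotp : potential p = p := by
    have := potential_add_int 0 σ
    simpa [potential_zero] using this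
  have hapS : a * (S : ℂ) = p := by
    apply Complex.ext
    · rw [hasre, hp]; simp
    · rw [(mul_ofReal_re_im a S).2, hσa, mul_assoc, haS, hp]; simp
  -- The left lift converges to the critical point `p`: translation by a period reduces uniqueness
  -- of the preimage of `p` to uniqueness of the zero of the potential.
  have hlim : Tendsto ζ₂ (𝓝[Ioo 0 S] S) (𝓝 p) := by
    refine tendsto_of_tendsto_potential (K := {ζ | ζ.re ≤ 0})
      (isClosed_le Complex.continuous_re continuous_const) (fun ζ hζ => Or.inl hζ)
      (eventually_of_mem self_mem_nhdsWithin fun s hs => (prop₂ s hs).2.le) ?_ fun q hq hqp => ?_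
    · have hmul : Continuous fun s : ℝ => a * (s : ℂ) := by fun_prop
      have : Tendsto (fun s : ℝ => a * (s : ℂ)) (𝓝[Ioo 0 S] S) (𝓝 (potential p)) := by
        rw [hpotp, ← hapS]
        exact (hmul.tendsto S).mono_left nhdsWithin_le_nhds
      exact this.congr' (eventually_of_mem self_mem_nhdsWithin fun s hs => (prop₂ s hs).1.symm)
    · have h1 : potential (q + (-σ : ℤ) * (2 * Real.pi * Complex.I)) = 0 := by
        rw [potential_add_int, hqp, hpotp, hp]
        push_cast
        ring
      have h2 := eq_zero_of_potential_eq_zero (Or.inl (by simpa using hq)) h1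
      rw [hp]
      push_cast at h2
      linear_combination h2
  set ζ₃ : ℝ → ℂ := fun s => if s < S then ζ₂ s else p with hζ₃
  have e₃ : ∀ s < S, ζ₃ s = ζ₂ s := fun s hs => if_pos hs
  have e₃' : ∀ s ≥ S, ζ₃ s = p := fun s hs => if_neg (not_lt.2 hs)
  have cont₃ : ContinuousOn ζ₃ (Ici 0) := by
    have hIco : ContinuousOn ζ₃ (Ico 0 S) := cont₂.congr fun s hs => e₃ s hs.2
    have hIcc : ContinuousOn ζ₃ (Icc 0 S) := by
      intro s hs
      rcases hs.2.eq_or_lt with rfl | hlt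
      · rw [← Ico_insert_right hs.1, continuousWithinAt_insert_self, ContinuousWithinAt,
          e₃' S le_rfl, ← Ioo_insert_left hSpos, nhdsWithin_insert_of_ne hSpos.ne']
        exact hlim.congr' (eventually_of_mem self_mem_nhdsWithin fun s hs => (e₃ s hs.2).symm)
      · exact (hIco s ⟨hs.1, hlt⟩).mono_of_mem_nhdsWithin
          (mem_of_superset (inter_mem_nhdsWithin _ (Iio_mem_nhds hlt))
            fun _ ht => ⟨ht.1.1, ht.2⟩)
    have hIci : ContinuousOn ζ₃ (Ici S) := continuousOn_const.congr fun s hs => e₃' s hs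
    rw [← Icc_union_Ici_eq_Ici hSpos.le]
    exact hIcc.union_of_isClosed hIci isClosed_Icc isClosed_Ici
  have prop₃ : ∀ s ∈ Ioo 0 S, potential (ζ₃ s) = a * (s : ℂ) ∧ (ζ₃ s).re < 0 := fun s hs => by
    rw [e₃ s hs.2]; exact prop₂ s hs
  have z₃ : ζ₃ 0 = 0 := (e₃ 0 hSpos).trans z₂
  refine ⟨fun s => ofLog c (ζ₁ s), fun s => ofLog c (ζ₃ s), ⟨hSpos, fun T => ?_, fun T hT => ?_,
    (continuous_ofLog c).comp_continuousOn cont₃, fun s hs => ?_,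
    fun s hs => ofLog_ne_of_re hc (prop₁ s hs.1).2.1 (prop₃ s hs).2⟩, ?_, fun s hs hin => ?_, ?_⟩
  · exact isReverseTrajectory_ofLog hc z₁ (cont₁ (T + 1)) (fun s hs => (prop₁ s hs.1).1)
      (fun s hs => exp_ne_one_of_re_ne_zero (prop₁ s hs.1).2.1.ne') (lt_add_one T)
  · exact isReverseTrajectory_ofLog hc z₃ (cont₃.mono Ico_subset_Ici_self)
      (fun s hs => (prop₃ s hs).1)
      (fun s hs => exp_ne_one_of_re_ne_zero (prop₃ s hs).2.ne) hT
  · rw [e₃' s hs, ofLog_eq_zero_iff hc, hexpp]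
  · exact tendsto_ofLog_cobounded ha0 hc (fun s hs => (prop₁ s hs).1)
      (fun s hs => by linarith [(prop₁ s hs).2.1]) (fun s hs => by linarith [(prop₁ s hs).2.2])
  · rw [qCoord, one_sub_ofLog hc] at hin
    have h1 : (potential (ζ₁ s)).re = 0 := by
      rcases hs.eq_or_lt with rfl | hs
      · rw [z₁, potential_zero, Complex.zero_re]
      · rw [(prop₁ s hs).1, hasre]
    exact hin.2.ne (norm_exp_eq_of_potential_re h1)
  · ext z
    constructor
    · rintro ⟨s, hs, rfl⟩
      rw [mem_preimage, qCoord, one_sub_ofLog hc]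
      rcases hs.1.eq_or_lt with rfl | h0
      · simp [z₃, loopSet]
      rcases hs.2.eq_or_lt with rfl | h1
      · simp [e₃' S le_rfl, hexpp, loopSet]
      · obtain ⟨h2, h3⟩ := prop₃ s ⟨h0, h1⟩
        refine ⟨?_, norm_exp_eq_of_potential_re (by rw [h2, hasre])⟩
        rw [Complex.norm_exp]
        exact Real.exp_le_one_iff.2 h3.le
    · intro hz
      have hz' : qCoord c z ∈ loopSet := hz
      by_cases hq1 : qCoord c z = 1
      · refine ⟨0, left_mem_Icc.2 hSpos.le, ?_⟩
        rw [← symm_qCoord hc z, hq1]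
        simp [z₃, ofLog]
      obtain ⟨ζ, h1, h2, h3, h4, h5⟩ := exists_log_of_mem_loopSet hz' hq1
      -- The lift of `q` lies above the segment from `0` to `2 π i`. For `σ = -1` the ray runs to
      -- `-2 π i`, so one period is subtracted and the segment is traversed backwards.
      obtain ⟨s, n, hs, hsn⟩ : ∃ (s : ℝ) (n : ℤ), s ∈ Ioo 0 S ∧
          potential (ζ + n * (2 * Real.pi * Complex.I)) = a * (s : ℂ) := by
        have hapos : 0 < ‖a‖ := norm_pos_iff.2 ha0
        have hSdiv : S = 2 * Real.pi / ‖a‖ := by rw [eq_div_iff hapos.ne', mul_comm, haS]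
        rcases hσ with rfl | rfl
        · refine ⟨(potential ζ).im / ‖a‖, 0, ⟨by positivity, ?_⟩, ?_⟩
          · rw [hSdiv]; gcongr
          · apply Complex.ext
            · rw [hasre]; simpa using h3
            · rw [(mul_ofReal_re_im a _).2, hσa]
              simp
              field_simp
        · refine ⟨(2 * Real.pi - (potential ζ).im) / ‖a‖, -1,
            ⟨div_pos (by linarith) hapos, ?_⟩, ?_⟩
          · rw [hSdiv]; gcongr; linarith
          · rw [potential_add_int]
            apply Complex.ext
            · rw [hasre]; simpa using h3
            · rw [(mul_ofReal_re_im a _).2, hσa]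
              simp
              field_simp
              ring
      have hζs : ζ + n * (2 * Real.pi * Complex.I) = ζ₃ s := by
        refine injOn_potential_re_neg ?_ (prop₃ s hs).2 (hsn.trans (prop₃ s hs).1.symm)
        simpa using h2
      refine ⟨s, ⟨hs.1.le, hs.2.le⟩, ?_⟩
      have hexp : Complex.exp (ζ₃ s) = qCoord c z := by
        rw [← h1, ← hζs]
        exact Complex.exp_eq_exp_iff_exists_int.2 ⟨n, rfl⟩
      change ofLog c (ζ₃ s) = z
      rw [ofLog, hexp, symm_qCoord hc]

theorem exists_isExoticCurve {c : ℂ} (h : c.re ^ 2 - c.im ^ 2 = 0) (hc : c ≠ 0) :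
    ∃ γ, IsExoticCurve (linearDriver c) γ (4 * Real.pi / ‖c‖ ^ 2) := by
  obtain ⟨γp, γm, hpair, hlim, hout, himg⟩ := exists_loopPair h hc
  set S := 4 * Real.pi / ‖c‖ ^ 2
  have hS := hpair.time_pos
  have h0 : γp 0 = γm 0 := (hpair.pos 0).start.trans hpair.neg_zero.symm
  have hneg : ∀ t ≤ 0, twoSided γp γm t = γm (-t) := fun t ht => by
    simpa using twoSided_neg (γp := γp) h0 (neg_nonneg.2 ht)
  have himage : twoSided γp γm '' Icc (-S) 0 = qCoord c ⁻¹' loopSet := by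
    rw [← himg]
    ext z
    constructor
    · rintro ⟨t, ht, rfl⟩
      exact ⟨-t, ⟨by linarith [ht.2], by linarith [ht.1]⟩, (hneg t ht.2).symm⟩
    · rintro ⟨t, ht, rfl⟩
      exact ⟨-t, ⟨by linarith [ht.2], by linarith [ht.1]⟩, twoSided_neg h0 ht.1⟩
  have hint : interiorOf (twoSided γp γm '' Icc (-S) 0) = qCoord c ⁻¹' loopInside := by
    rw [himage, interiorOf_preimage_loopSet hc]
  have hopen : IsOpen (qCoord c ⁻¹' loopInside) :=
    isOpen_loopInside.preimage (continuous_qCoord c)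
  have hconn := isConnected_preimage_loopInside hc
  have hdisj : ∀ t : ℝ, 0 ≤ t →
      Disjoint (qCoord c ⁻¹' loopInside) (leftHull (linearDriver c) t) := by
    intro t ht
    rw [hpair.creates.hull t ht, Set.disjoint_right]
    rintro _ ⟨s, hs, rfl⟩ hin
    rcases le_total 0 s with h' | h'
    · rw [twoSided_of_nonneg h'] at hin
      exact hout s h' hin
    · have hmem : twoSided γp γm s ∈ qCoord c ⁻¹' loopSet := by
        rcases le_total (-s) S with h'' | h''
        · rw [← himage]
          exact ⟨s, ⟨by linarith, h'⟩, rfl⟩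
        · rw [hneg s h', hpair.rests _ h'']
          simp [qCoord, loopSet]
      have h1 : qCoord c (twoSided γp γm s) ∈ loopSetᶜ := by
        rw [compl_loopSet]; exact Or.inl hin
      exact h1 hmem
  refine ⟨twoSided γp γm, ⟨hpair.creates, ?_, ?_, ⟨by linarith,
    hpair.creates.continuous.continuousOn, ?_, ?_, ?_⟩, fun s hs => ?_, ?_, ?_, ?_, ?_, ?_, ?_, ?_⟩⟩
  · exact hpair.pos_injOn.congr fun t ht => (twoSided_of_nonneg ht).symm
  · exact hlim.congr' ((eventually_ge_atTop 0).mono fun t ht => (twoSided_of_nonneg ht).symm)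
  · rw [twoSided_neg h0 hS.le, hpair.rests S le_rfl]
  · rw [twoSided_of_nonneg le_rfl, (hpair.pos 0).start]
  · intro s hs t ht hst
    rw [hneg s hs.2, hneg t ht.2] at hst
    have := hpair.neg_injOn ⟨by linarith [hs.2], by linarith [hs.1]⟩
      ⟨by linarith [ht.2], by linarith [ht.1]⟩ hst
    linarith
  · rw [hneg s (by linarith), hpair.rests _ (by linarith)]
  · refine Subset.antisymm ?_ ?_
    · rintro _ ⟨⟨s, hs, rfl⟩, ⟨t, ht, hst⟩⟩
      have hs' : 0 ≤ s := hs
      have ht' : t ≤ 0 := ht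
      rw [hneg t ht', twoSided_of_nonneg hs'] at hst
      rw [mem_singleton_iff, twoSided_of_nonneg hs']
      exact hpair.eq_zero_of_pos_eq_neg hs' (neg_nonneg.2 ht') hst.symm
    · rintro _ rfl
      have : twoSided γp γm 0 = 0 := by rw [twoSided_of_nonneg le_rfl, (hpair.pos 0).start]
      exact ⟨⟨0, mem_Ici.2 le_rfl, this⟩, ⟨0, mem_Iic.2 le_rfl, this⟩⟩
  · rw [hint]; exact hopen
  · rw [hint]; exact hconn
  · rw [hint]; exact isBounded_preimage_loopInside hc
  · rw [hint]; exact hopen.measure_pos volume hconn.nonempty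
  · rw [hint]; exact hdisj
  · intro t ht z hz
    rw [hint] at hz ⊢
    have ht0 : 0 ≤ t := hS.le.trans ht
    have hsub : qCoord c ⁻¹' loopInside ⊆ (leftHull (linearDriver c) t)ᶜ :=
      (hdisj t ht0).subset_compl_right
    refine Subset.antisymm ?_ (hconn.isPreconnected.subset_connectedComponentIn hz hsub)
    -- From time `S` on the hull contains the whole loop, so a component of its complement cannot
    -- pass from inside to outside.
    refine IsPreconnected.subset_left_of_subset_union hopen
      (isOpen_loopOutside.preimage (continuous_qCoord c))
      (disjoint_loopInside_loopOutside.preimage _) ?_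
      ⟨z, mem_connectedComponentIn (hsub hz), hz⟩ isPreconnected_connectedComponentIn
    rw [← preimage_union, ← compl_loopSet, preimage_compl, ← himage]
    refine (connectedComponentIn_subset _ _).trans (compl_subset_compl.2 ?_)
    rw [hpair.creates.hull t ht0]
    exact image_mono (Icc_subset_Icc (by linarith) ht0)

/-! ### Assembly of the trichotomy. -/

theorem mainTheorem1 :
    -- every complex linear driver creates a two-sided curve
    (∀ c : ℂ, ∃ γ : ℝ → ℂ, CreatesTwoSidedCurve (linearDriver c) γ) ∧
    -- (i) the simple phase
    (∀ c : ℂ, (∃ γ : ℝ → ℂ, IsSimpleCurve (linearDriver c) γ) ↔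
      (0 < c.re ^ 2 - c.im ^ 2 ∨ c = 0)) ∧
    -- (ii) the phase in which one end of the simple curve spirals
    (∀ c : ℂ, (∃ (γ : ℝ → ℂ) (p : ℂ), IsSimpleCurveEndingAt (linearDriver c) γ p) ↔
      c.re ^ 2 - c.im ^ 2 < 0) ∧
    (∀ (c : ℂ) (γ : ℝ → ℂ) (p : ℂ), IsSimpleCurveEndingAt (linearDriver c) γ p →
      p = 2 / c ∧
      (c.re ≠ 0 → WindsInfinitely (fun t => γ (-t)) p) ∧
      (c.re = 0 → ∀ t : ℝ, 0 ≤ t → γ (-t) ∈ segment ℝ 0 p)) ∧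
    -- (iii) the exotic phase
    (∀ c : ℂ, (∃ (γ : ℝ → ℂ) (T : ℝ), IsExoticCurve (linearDriver c) γ T) ↔
      (c.re ^ 2 - c.im ^ 2 = 0 ∧ c ≠ 0)) ∧
    (∀ (c : ℂ) (γ : ℝ → ℂ) (T : ℝ), IsExoticCurve (linearDriver c) γ T →
      T = 4 * Real.pi / ‖c‖ ^ 2) := by
  have simple : ∀ c : ℂ, (0 < c.re ^ 2 - c.im ^ 2 ∨ c = 0) → ∃ γp γm, IsBranchPair c γp γm ∧
      Tendsto γp atTop (Bornology.cobounded ℂ) ∧ Tendsto γm atTop (Bornology.cobounded ℂ) := by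
    rintro c (h | rfl)
    · exact exists_branchPair_of_pos h
    · exact exists_branchPair_zero
  have cases : ∀ c : ℂ, (0 < c.re ^ 2 - c.im ^ 2 ∨ c = 0) ∨ c.re ^ 2 - c.im ^ 2 < 0 ∨
      (c.re ^ 2 - c.im ^ 2 = 0 ∧ c ≠ 0) := by
    intro c
    by_cases hc : c = 0
    · exact Or.inl (Or.inr hc)
    rcases lt_trichotomy (c.re ^ 2 - c.im ^ 2) 0 with h | h | h
    · exact Or.inr (Or.inl h)
    · exact Or.inr (Or.inr ⟨h, hc⟩)
    · exact Or.inl (Or.inl h)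
  have disj : ∀ {f : ℝ → ℂ} {p : ℂ}, Tendsto f atTop (𝓝 p) →
      ¬ Tendsto f atTop (Bornology.cobounded ℂ) := fun hp hinf =>
    (Metric.disjoint_nhds_cobounded _).le_bot.not_gt (by
      have := (le_inf hp hinf : map _ atTop ≤ _)
      exact bot_lt_iff_ne_bot.2 (NeBot.mono inferInstance this).ne)
  have reparam : ∀ {f g : ℝ → ℂ} {l : Filter ℂ}, (∀ t, 0 ≤ t → f t = g t) →
      Tendsto g atTop l → Tendsto f atTop l := fun hfg hg =>
    hg.congr' ((eventually_ge_atTop 0).mono fun t ht => (hfg t ht).symm)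
  -- a curve with an end at a finite point exists in the second phase only
  have ending : ∀ (c : ℂ) (γ : ℝ → ℂ) (p : ℂ), IsSimpleCurveEndingAt (linearDriver c) γ p →
      c.re ^ 2 - c.im ^ 2 < 0 := by
    intro c γ p hγ
    rcases cases c with h | h | ⟨h, hc⟩
    · exfalso
      obtain ⟨γp, γm, hpair, hp, hm⟩ := simple c h
      rcases hpair.eq_or_eq_of_injective hγ.creates hγ.injective with e | e
      · exact disj hγ.tendsto_neg (reparam (fun t ht => (e t ht).2) hm)
      · exact disj hγ.tendsto_neg (reparam (fun t ht => (e t ht).2) hp)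
    · exact h
    · obtain ⟨γp, γm, hpair, -⟩ := exists_loopPair h hc
      exact absurd hγ.injective (hpair.not_injective hγ.creates)
  have exotic : ∀ (c : ℂ) (γ : ℝ → ℂ) (T : ℝ), IsExoticCurve (linearDriver c) γ T →
      c.re ^ 2 - c.im ^ 2 = 0 ∧ c ≠ 0 := by
    intro c γ T hγ
    rcases cases c with h | h | h
    · obtain ⟨γp, γm, hpair, -⟩ := simple c h
      exact absurd hγ hpair.not_isExoticCurve
    · obtain ⟨γp, γm, hpair, -⟩ := exists_branchPair_of_neg h
      exact absurd hγ hpair.not_isExoticCurve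
    · exact h
  refine ⟨fun c => ?_, fun c => ⟨?_, fun h => ?_⟩, fun c => ⟨?_, fun h => ?_⟩, ?_,
    fun c => ⟨?_, fun h => ?_⟩, ?_⟩
  · rcases cases c with h | h | ⟨h, hc⟩
    · obtain ⟨γp, γm, hpair, -⟩ := simple c h
      exact ⟨_, hpair.creates⟩
    · obtain ⟨γp, γm, hpair, -⟩ := exists_branchPair_of_neg h
      exact ⟨_, hpair.creates⟩
    · obtain ⟨γp, γm, hpair, -⟩ := exists_loopPair h hc
      exact ⟨_, hpair.creates⟩
  · rintro ⟨γ, hγ⟩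
    rcases cases c with h | h | ⟨h, hc⟩
    · exact h
    · exfalso
      obtain ⟨γp, γm, hpair, -, hm, -⟩ := exists_branchPair_of_neg h
      rcases hpair.eq_or_eq_of_injective hγ.creates hγ.injective with e | e
      · exact disj (reparam (fun t ht => (e t ht).2) hm) hγ.tendsto_neg
      · exact disj (reparam (fun t ht => (e t ht).1) hm) hγ.tendsto_pos
    · obtain ⟨γp, γm, hpair, -⟩ := exists_loopPair h hc
      exact absurd hγ.injective (hpair.not_injective hγ.creates)
  · obtain ⟨γp, γm, hpair, hp, hm⟩ := simple c h
    exact ⟨_, hpair.creates, hpair.injective,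
      reparam (fun t ht => twoSided_of_nonneg ht) hp,
      reparam (fun t ht => hpair.twoSided_neg ht) hm⟩
  · rintro ⟨γ, p, hγ⟩
    exact ending c γ p hγ
  · obtain ⟨γp, γm, hpair, hp, hm, hne, -⟩ := exists_branchPair_of_neg h
    refine ⟨_, 2 / c, hpair.creates, hpair.injective,
      reparam (fun t ht => twoSided_of_nonneg ht) hp,
      reparam (fun t ht => hpair.twoSided_neg ht) hm, ?_⟩
    rintro ⟨t, ht⟩
    rw [twoSided] at ht
    split_ifs at ht
    · exact (hne _).1 ht
    · exact (hne _).2 ht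
  · intro c γ p hγ
    obtain ⟨γp, γm, hpair, hp, hm, -, hwind, hseg⟩ := exists_branchPair_of_neg (ending c γ p hγ)
    rcases hpair.eq_or_eq_of_injective hγ.creates hγ.injective with e | e
    · have hpc : p = 2 / c :=
        tendsto_nhds_unique hγ.tendsto_neg (reparam (fun t ht => (e t ht).2) hm)
      subst hpc
      refine ⟨rfl, fun hre => ?_, fun hre t ht => ?_⟩
      · obtain ⟨θ, h1, h2, h3⟩ := hwind hre
        exact ⟨θ, h1, fun t ht => by simpa only [(e t ht).2] using h2 t ht, h3⟩
      · rw [(e t ht).2]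
        exact hseg hre t ht
    -- The opposite orientation is impossible: its negative end would be the branch that escapes to
    -- infinity.
    · exact absurd (reparam (fun t ht => (e t ht).2) hp) (disj hγ.tendsto_neg)
  · rintro ⟨γ, T, hγ⟩
    exact exotic c γ T hγ
  · obtain ⟨γ, hγ⟩ := exists_isExoticCurve h.1 h.2
    exact ⟨γ, _, hγ⟩
  · intro c γ T hγ
    obtain ⟨h, hc⟩ := exotic c γ T hγ
    obtain ⟨γp, γm, hpair, -⟩ := exists_loopPair h hc
    exact hpair.exotic_time_eq hγ
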